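/- Let $M=\{0,1\}^{\mathbb Z}$ with the product topology, let $f$ be the left shift, and fix $\rho\in(0,1)$, with the metric $d(x,y)=\rho^{N(x,y)}$, $N(x,y)=\min\{|i|:x_i\neq y_i\}$ for $x\ne y$. For $p\in(0,1)$ let $\mu_p=(p\delta_1+(1-p)\delta_0)^{\mathbb Z}$. For a continuous $A:M\to SL(2,\mathbb R)$ put $A^n(x)=A(f^{n-1}x)\cdots A(x)$ for $n\ge 1$; its Lyapunov exponents $\lambda_+(A)$, $\lambda_-(A)$ are the $\mu_p$-almost everywhere constant limits of $\frac1n\log\|A^n(x)\|$ and $\frac1n\log\|A^n(x)^{-1}\|^{-1}$, where $\|\cdot\|$ is the Euclidean operator norm. For $0<\delta<1$ let $$\|F\|_{\delta\text{-}\log}=\sup_{x}\|F(x)\|+\sup_{x\neq y}\|F(x)-F(y)\|\Big(\log\frac1{d(x,y)}\Big)^{\delta},$$ and let $C_{\delta\text{-}\log}$ be the set of continuous $A:M\to SL(2,\mathbb R)$ with $\|A\|_{\delta\text{-}\log}<\infty$, with the distance $\|A-B\|_{\delta\text{-}\log}$. The cocycle $A$ is uniformly hyperbolic if there are $C>0$,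 $r\in(0,1)$ and, for every $x\in M$, lines $E^s_x$, $E^u_x$ with $\mathbb R^2=E^s_x\oplus E^u_x$, $A(x)E^{s}_x=E^{s}_{f(x)}$, $A(x)E^{u}_x=E^{u}_{f(x)}$ and, for all $n\ge0$, $\|A^n(x)v\|\le Cr^n\|v\|$ for $v\in E^s_x$ and $\|A^{n}(f^{-n}x)^{-1}v\|\le Cr^n\|v\|$ for $v\in E^u_x$. Let $\sigma>1$, $D=\mathrm{diag}(\sigma,\sigma^{-1})$, and let $A_{\sigma1}(x)=\mathrm{Id}$ if $x_0=0$ and $A_{\sigma1}(x)=D$ if $x_0=1$. Then, for all $\rho,\delta,p\in(0,1)$ and all $\sigma>1$: (1) $\lambda_\pm(A_{\sigma1})=\pm p\log\sigma\neq0$, and $A_{\sigma1}$ maps each of the two coordinate axes onto itself at every point. (2) $A_{\sigma1}$ lies on the boundary, in $C^0(M,SL(2,\mathbb R))$, of the set of uniformly hyperbolic cocycles. (3) $A_{\sigma1}\in C_{\delta\text{-}\log}$, and for every $\varepsilon>0$ there is $B\in C_{\delta\text{-}\log}$ with $\|B-A_{\sigma1}\|_{\delta\text{-}\log}<\varepsilon$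 and $\lambda_\pm(B)=0$. In particular neither $\lambda_+$ nor $\lambda_-$ is continuous at $A_{\sigma1}$ as a function on $C_{\delta\text{-}\log}$. (4) Explicitly, let $R_\theta$ be the rotation of angle $\theta$, and for $k\ge1$ let $Z_k=\{x:x_0=\dots=x_{k-1}=0,\ x_k=1\}$. Let $B_k(x)=A_{\sigma1}(x)R_{\pi/(2k)}$ if $x\in\bigcup_{i=0}^{k-1}f^i(Z_k)$ and $B_k(x)=A_{\sigma1}(x)$ otherwise. Then $B_k\in C_{\delta\text{-}\log}$ and $\lambda_\pm(B_k)=0$ for every $k\ge1$, the matrix $B_k^k(x)$ interchanges the two coordinate axes for every $x\in Z_k$, and $\|B_k-A_{\sigma1}\|_{\delta\text{-}\log}\to0$ as $k\to\infty$. (5) Let $\delta<\beta<1$. For $k\ge2$ let $W_k=\{x:x_0=\dots=x_k=0,\ x_{k+1}=\dots=x_{2k}=1\}$, $a_k=k^{-\beta}$, $\theta_k=\arctan\frac{1}{a_k(1+a_k)^{2k}}$ and $\gamma_k=\frac{a_k(1+a_k)^{2k}}{\sigma^{2k-2}}$. Let $L_k(x)=A_{\sigma1}(x)G(x)$, where $G(x)=\begin{pmatrix}1&0\\a_k&1\end{pmatrix}$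 on $W_k$, $G(x)=\mathrm{diag}((1+a_k)^{-1},1+a_k)$ on $\bigcup_{i=1}^kf^i(W_k)$, $G(x)=R_{\theta_k}$ on $f^{k+1}(W_k)$, $G(x)=\begin{pmatrix}1&0\\\gamma_k&1\end{pmatrix}$ on $f^{2k}(W_k)$, and $G(x)=\mathrm{Id}$ elsewhere. Then $L_k\in C_{\delta\text{-}\log}$ and $\lambda_\pm(L_k)=0$ for every $k\ge2$, the matrix $L_k^{2k+1}(x)$ interchanges the two coordinate axes for every $x\in W_k$, and $\|L_k-A_{\sigma1}\|_{\delta\text{-}\log}\to0$ as $k\to\infty$. -/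

import Mathlib

open Set Filter Topology MeasureTheory
open scoped ENNReal

namespace LogHolderCocycle

/-- The space `{0,1}^ℤ`, with the product topology and the product σ-algebra. -/
abbrev Shift2 : Type := ℤ → Fin 2

/-- Real `2 × 2` matrices. -/
abbrev Mat2 : Type := Matrix (Fin 2) (Fin 2) ℝ

/-- The group `SL(2, ℝ)`. -/
abbrev SL2 : Type := Matrix.SpecialLinearGroup (Fin 2) ℝ

/-- The Euclidean plane. -/
abbrev Plane : Type := EuclideanSpace ℝ (Fin 2)

/-- Continuous `SL(2, ℝ)`-valued cocycles over the shift, with the `C⁰` topology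
(the compact-open topology, which is uniform convergence since `Shift2` is compact). -/
abbrev Cocycle : Type := C(Shift2, SL2)

/-! ### The Bernoulli shift -/

/-- The left shift, as a bijection. -/
def shift : Equiv.Perm Shift2 where
  toFun x := fun i => x (i + 1)
  invFun x := fun i => x (i - 1)
  left_inv x := by funext i; simp
  right_inv x := by funext i; simp

/-- `N(x, y) = min {|i| : x_i ≠ y_i}` (used for `x ≠ y` only). -/
noncomputable def firstDiff (x y : Shift2) : ℕ :=
  sInf {n : ℕ | ∃ i : ℤ, i.natAbs = n ∧ x i ≠ y i}

open Classical in
/-- The metric `d_ρ(x, y) = ρ ^ N(x, y)`. -/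
noncomputable def dRho (ρ : ℝ) (x y : Shift2) : ℝ :=
  if x = y then 0 else ρ ^ firstDiff x y

/-- The measure `p δ₁ + (1 - p) δ₀` on `{0, 1}`. -/
noncomputable def coin (p : ℝ) : Measure (Fin 2) :=
  ENNReal.ofReal p • Measure.dirac 1 + ENNReal.ofReal (1 - p) • Measure.dirac 0

/-- The Bernoulli measure `μ_p`. -/
noncomputable def bernoulliMeasure (p : ℝ) : Measure Shift2 :=
  Measure.infinitePi (fun _ : ℤ => coin p)

/-! ### Cocycles, Lyapunov exponents, uniform hyperbolicity -/

/-- The action of a matrix on the Euclidean plane. -/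
noncomputable def act (m : Mat2) : Plane →L[ℝ] Plane :=
  Matrix.toEuclideanCLM (n := Fin 2) (𝕜 := ℝ) m

/-- The operator norm of a matrix for the Euclidean norm. -/
noncomputable def opNorm (m : Mat2) : ℝ := ‖act m‖

/-- The forward products `A(f^{n-1} x) ⋯ A(x)`. -/
def fwd (A : Cocycle) : ℕ → Shift2 → SL2
  | 0, _ => 1
  | n + 1, x => A ((shift ^ n) x) * fwd A n x

/-- The iterates `Aⁿ(x)`, `n ∈ ℤ`, with `A^{-n}(x) = Aⁿ(f^{-n} x)⁻¹`. -/
def iter (A : Cocycle) : ℤ → Shift2 → SL2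
  | Int.ofNat n, x => fwd A n x
  | Int.negSucc n, x => (fwd A (n + 1) ((shift ^ (Int.negSucc n)) x))⁻¹

/-- `(1/n) log ‖Aⁿ(x)‖ → l` for almost every `x`, that is, `λ₊(A, μ_p) = l`. -/
def IsUpperExponent (p : ℝ) (A : Cocycle) (l : ℝ) : Prop :=
  ∀ᵐ x ∂(bernoulliMeasure p),
    Tendsto (fun n : ℕ => (1 / (n : ℝ)) * Real.log (opNorm (iter A n x))) atTop (𝓝 l)

/-- `(1/n) log ‖Aⁿ(x)⁻¹‖⁻¹ → l` for almost every `x`, that is, `λ₋(A, μ_p) = l`. -/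
def IsLowerExponent (p : ℝ) (A : Cocycle) (l : ℝ) : Prop :=
  ∀ᵐ x ∂(bernoulliMeasure p),
    Tendsto (fun n : ℕ =>
      (1 / (n : ℝ)) * Real.log (opNorm ((iter A n x)⁻¹ : SL2))⁻¹) atTop (𝓝 l)

/-- Both Lyapunov exponents exist and vanish. -/
def ZeroExponents (p : ℝ) (A : Cocycle) : Prop :=
  IsUpperExponent p A 0 ∧ IsLowerExponent p A 0

open Classical in
/-- The function `A ↦ λ₊(A, μ_p)` (by the Furstenberg–Kesten theorem and ergodicity
the first case always applies when `0 < p < 1`). -/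
noncomputable def upperExponent (p : ℝ) (A : Cocycle) : ℝ :=
  if h : ∃ l, IsUpperExponent p A l then h.choose else 0

open Classical in
/-- The function `A ↦ λ₋(A, μ_p)`. -/
noncomputable def lowerExponent (p : ℝ) (A : Cocycle) : ℝ :=
  if h : ∃ l, IsLowerExponent p A l then h.choose else 0

/-- Uniform hyperbolicity: an invariant splitting into two lines, uniformly contracted
in forward, respectively backward, time. -/
def UniformlyHyperbolic (A : Cocycle) : Prop :=
  ∃ (Es Eu : Shift2 → Submodule ℝ Plane) (C r : ℝ), 0 < C ∧ 0 < r ∧ r < 1 ∧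
    ∀ x, Module.finrank ℝ (Es x) = 1 ∧ Module.finrank ℝ (Eu x) = 1 ∧
      IsCompl (Es x) (Eu x) ∧
      (Es x).map (act (A x)).toLinearMap = Es (shift x) ∧
      (Eu x).map (act (A x)).toLinearMap = Eu (shift x) ∧
      (∀ n : ℕ, ∀ v ∈ Es x, ‖act (iter A n x) v‖ ≤ C * r ^ n * ‖v‖) ∧
      (∀ n : ℕ, ∀ v ∈ Eu x, ‖act (iter A (-(n : ℤ)) x) v‖ ≤ C * r ^ n * ‖v‖)

/-- The set of uniformly hyperbolic cocycles. -/
def UH : Set Cocycle := {A | UniformlyHyperbolic A}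

/-! ### The `δ`-log-Hölder norm -/

/-- `‖F‖_{δ-log} = sup_x ‖F x‖ + sup_{x ≠ y} ‖F x - F y‖ (log (1 / d(x, y))) ^ δ`. -/
noncomputable def logNorm (ρ δ : ℝ) (F : Shift2 → Mat2) : ℝ≥0∞ :=
  (⨆ x, ENNReal.ofReal (opNorm (F x))) +
    ⨆ (x) (y) (_ : x ≠ y),
      ENNReal.ofReal (opNorm (F x - F y) * (Real.log (1 / dRho ρ x y)) ^ δ)

/-- The `δ`-log-Hölder cocycles. -/
def CLog (ρ δ : ℝ) : Set Cocycle :=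
  {A | logNorm ρ δ (fun x => (A x : Mat2)) < ∞}

/-- The distance `‖A - B‖_{δ-log}`. -/
noncomputable def logDist (ρ δ : ℝ) (A B : Cocycle) : ℝ≥0∞ :=
  logNorm ρ δ (fun x => (A x : Mat2) - (B x : Mat2))

/-- Continuity of `Φ : C_{δ-log} → ℝ` at the point `A`, in the `C_{δ-log}` topology. -/
def LogContinuousAt (ρ δ : ℝ) (Φ : Cocycle → ℝ) (A : Cocycle) : Prop :=
  ∀ ε : ℝ, 0 < ε → ∃ η : ℝ≥0∞, 0 < η ∧
    ∀ B ∈ CLog ρ δ, logDist ρ δ B A < η → |Φ B - Φ A| < ε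

/-! ### Matrices -/

/-- `diag(a, a⁻¹)`. -/
noncomputable def diagSL (a : ℝ) (ha : 0 < a) : SL2 :=
  ⟨!![a, 0; 0, a⁻¹], by simp [Matrix.det_fin_two, ha.ne']⟩

/-- The rotation of angle `θ`. -/
noncomputable def rotSL (θ : ℝ) : SL2 :=
  ⟨!![Real.cos θ, -Real.sin θ; Real.sin θ, Real.cos θ], by
    have h := Real.cos_sq_add_sin_sq θ
    simp only [Matrix.det_fin_two_of]
    linarith⟩

/-- The lower triangular shear. -/
def shearSL (a : ℝ) : SL2 :=
  ⟨!![1, 0; a, 1], by simp [Matrix.det_fin_two]⟩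

/-- The coordinate line spanned by `e₁` (`i = 0`) or `e₂` (`i = 1`). -/
noncomputable def axis (i : Fin 2) : Submodule ℝ Plane :=
  Submodule.span ℝ {EuclideanSpace.single i (1 : ℝ)}

/-- The matrix maps each of the two coordinate lines onto the other one. -/
def SwapsAxes (m : SL2) : Prop :=
  (axis 0).map (act m).toLinearMap = axis 1 ∧ (axis 1).map (act m).toLinearMap = axis 0

/-! ### The cocycles -/

lemma continuous_shift : Continuous shift :=
  continuous_pi fun i => continuous_apply (i + 1)

lemma continuous_shift_symm : Continuous shift.symm :=
  continuous_pi fun i => continuous_apply (i - 1)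

lemma isClopen_image {S : Set Shift2} (hS : IsClopen S) (n : ℕ) :
    IsClopen ((shift ^ n : Equiv.Perm Shift2) '' S) := by
  induction n with
  | zero => simpa using hS
  | succ n ih =>
    have h : ((shift ^ (n + 1) : Equiv.Perm Shift2) '' S) =
        shift.symm ⁻¹' ((shift ^ n : Equiv.Perm Shift2) '' S) := by
      rw [pow_succ', ← Equiv.image_eq_preimage_symm, ← Set.image_comp]
      rfl
    rw [h]
    exact ih.preimage continuous_shift_symm

lemma isClopen_coord (i : ℤ) (a : Fin 2) : IsClopen {x : Shift2 | x i = a} :=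
  (isClopen_discrete ({a} : Set (Fin 2))).preimage (continuous_apply i)

open Classical in
/-- The cocycle equal to `A` on a clopen set `S` and to `B` off `S`. -/
noncomputable def glue (S : Set Shift2) (hS : IsClopen S) (A B : Cocycle) : Cocycle where
  toFun x := if x ∈ S then A x else B x
  continuous_toFun := by
    refine Continuous.if (fun x hx => ?_) A.continuous B.continuous
    have h : frontier {x | x ∈ S} = ∅ := hS.frontier_eq
    rw [h] at hx
    exact hx.elim

/-- The cocycle equal to the identity on `[0; 0]` and to `diag(σ, σ⁻¹)` on `[0; 1]`. -/
noncomputable def cocA (σ : ℝ) (hσ : 1 < σ) : Cocycle :=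
  glue {x | x 0 = 1} (isClopen_coord 0 1)
    (ContinuousMap.const _ (diagSL σ (one_pos.trans hσ))) (ContinuousMap.const _ 1)

/-- The cocycle `x ↦ A(x) g`. -/
def mulConst (A : Cocycle) (g : SL2) : Cocycle where
  toFun x := A x * g
  continuous_toFun := A.continuous.mul continuous_const

/-- The cylinder `[0; 0⋯01]`, with `k` symbols `0`. -/
def cylZ (k : ℕ) : Set Shift2 :=
  {x | (∀ j ∈ Finset.range k, x (j : ℤ) = 0) ∧ x (k : ℤ) = 1}

/-- The cylinder `[0; 0⋯01⋯1]`, with `k + 1` symbols `0` and `k` symbols `1`. -/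
def cylW (k : ℕ) : Set Shift2 :=
  {x | (∀ j ∈ Finset.range (k + 1), x (j : ℤ) = 0) ∧
    (∀ j ∈ Finset.Icc (k + 1) (2 * k), x (j : ℤ) = 1)}

lemma isClopen_ball (s : Finset ℕ) (a : Fin 2) :
    IsClopen {x : Shift2 | ∀ j ∈ s, x (j : ℤ) = a} := by
  have h : {x : Shift2 | ∀ j ∈ s, x (j : ℤ) = a} = ⋂ j ∈ s, {x : Shift2 | x (j : ℤ) = a} := by
    ext x; simp
  rw [h]
  exact isClopen_biInter_finset fun j _ => isClopen_coord j a

lemma isClopen_cylZ (k : ℕ) : IsClopen (cylZ k) :=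
  (isClopen_ball _ 0).inter (isClopen_coord k 1)

lemma isClopen_cylW (k : ℕ) : IsClopen (cylW k) :=
  (isClopen_ball _ 0).inter (isClopen_ball _ 1)

/-- `f^a(S) ∪ ⋯ ∪ f^{b-1}(S)`. -/
def tower (S : Set Shift2) (a b : ℕ) : Set Shift2 :=
  ⋃ i ∈ Finset.Ico a b, (shift ^ i : Equiv.Perm Shift2) '' S

lemma isClopen_tower {S : Set Shift2} (hS : IsClopen S) (a b : ℕ) : IsClopen (tower S a b) :=
  isClopen_biUnion_finset fun i _ => isClopen_image hS i

/-- First family: `A` composed with the rotation of angle `π / (2k)` on the `k` sets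
`Z_k, f(Z_k), …, f^{k-1}(Z_k)`. -/
noncomputable def cocB (σ : ℝ) (hσ : 1 < σ) (k : ℕ) : Cocycle :=
  glue (tower (cylZ k) 0 k) (isClopen_tower (isClopen_cylZ k) 0 k)
    (mulConst (cocA σ hσ) (rotSL (Real.pi / (2 * k)))) (cocA σ hσ)

/-- The small parameter `k^{-β}`. -/
noncomputable def small (β : ℝ) (k : ℕ) : ℝ := (k : ℝ) ^ (-β)

lemma small_nonneg (β : ℝ) (k : ℕ) : 0 ≤ small β k :=
  Real.rpow_nonneg (Nat.cast_nonneg k) _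

lemma one_add_small_pos (β : ℝ) (k : ℕ) : 0 < 1 + small β k :=
  add_pos_of_pos_of_nonneg one_pos (small_nonneg β k)

/-- The angle with `tan θ = 1 / (k^{-β} (1 + k^{-β})^{2k})`. -/
noncomputable def angle (β : ℝ) (k : ℕ) : ℝ :=
  Real.arctan (1 / (small β k * (1 + small β k) ^ (2 * k)))

/-- The coefficient `k^{-β} (1 + k^{-β})^{2k} / σ^{2k-2}` of the last shear. -/
noncomputable def lastShear (σ β : ℝ) (k : ℕ) : ℝ :=
  small β k * (1 + small β k) ^ (2 * k) / σ ^ (2 * k - 2)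

/-- Second family (for `k ≥ 2`): `A` composed with a shear on `W_k`, with a hyperbolic matrix
on `f(W_k), …, f^k(W_k)`, with a rotation on `f^{k+1}(W_k)`, and with a shear on `f^{2k}(W_k)`. -/
noncomputable def cocL (σ : ℝ) (hσ : 1 < σ) (β : ℝ) (k : ℕ) : Cocycle :=
  glue (cylW k) (isClopen_cylW k)
    (mulConst (cocA σ hσ) (shearSL (small β k))) <|
  glue (tower (cylW k) 1 (k + 1)) (isClopen_tower (isClopen_cylW k) 1 (k + 1))
    (mulConst (cocA σ hσ)
      (diagSL (1 + small β k)⁻¹ (inv_pos.mpr (one_add_small_pos β k)))) <|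
  glue ((shift ^ (k + 1) : Equiv.Perm Shift2) '' cylW k) (isClopen_image (isClopen_cylW k) (k + 1))
    (mulConst (cocA σ hσ) (rotSL (angle β k))) <|
  glue ((shift ^ (2 * k) : Equiv.Perm Shift2) '' cylW k) (isClopen_image (isClopen_cylW k) (2 * k))
    (mulConst (cocA σ hσ) (shearSL (lastShear σ β k)))
    (cocA σ hσ)

end LogHolderCocycle

namespace LogHolderCocycle

/-! ### Operator norms of `2 × 2` matrices -/

/-! The diagonal cocycle is explicit: its iterates are powers of `D` counted by the number of ones,
so the strong law gives its exponents. Composing with `diag(e^t, e^{-t})`, `t > 0`, makes it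
uniformly hyperbolic, while at the fixed point `0^∞` it is the identity; hence it is a boundary
point.

Both perturbations live on a tower over a cylinder `W` and replace the product along the tower by
one fixed antidiagonal matrix `q`. After correcting by the unfinished part of the current passage,
all iterates are monomial: diagonal or antidiagonal. Let `s_n` be the logarithm of the nonzero entry
of the first row. Then `s_{n+1} = g s_n + φ` at `f^n x`, where `g = -1` on `W` and `g = 1`
elsewhere. So `|s_n|` is the absolute value of a sum of bounded terms twisted by the parity of the
visits to `W`, and both exponents vanish as soon as this sum is `o(n)` (`zeroExponents_of_tower`).

The twisted sum is controlled by correlations (`ae_tendsto_signed_average`). Two terms at distance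
`d` multiply to a bounded function times a sign that counts the visits in between. A suitable word
has two symbols whose exchange changes that count by an odd number. The exchange preserves the
Bernoulli measure, so wherever the word occurs in between, the contributions cancel
(`FlipWord.abs_integral_le`); the probability that it occurs nowhere is exponentially small in `d`.
Summable correlations give an `O(n)` second moment, hence almost sure convergence of the averages
along squares, and bounded increments fill the gaps.

Smallness in the log norm is cheap because the perturbation depends on `O(k)` coordinates: the
modulus of continuity costs only a factor `k^δ` (`logNorm_le_of_dependsOn`). A rotation of angle
`π/(2k)` is of order `k^{-1}`, and `δ < 1`; in the second family the main size is `k^{-β}` with `β >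
δ`, the other terms decaying faster than any power of `k`. -/

lemma act_apply (m : Mat2) (v : Plane) (i : Fin 2) :
    act m v i = m i 0 * v 0 + m i 1 * v 1 := by
  change (Matrix.mulVec m (WithLp.ofLp v)) i = _
  simp [Matrix.mulVec, dotProduct, Fin.sum_univ_two]

lemma act_mul (m m' : Mat2) : act (m * m') = (act m).comp (act m') :=
  map_mul (Matrix.toEuclideanCLM (n := Fin 2) (𝕜 := ℝ)) m m'

lemma act_one : act 1 = ContinuousLinearMap.id ℝ Plane :=
  map_one (Matrix.toEuclideanCLM (n := Fin 2) (𝕜 := ℝ))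

lemma opNorm_nonneg (m : Mat2) : 0 ≤ opNorm m := norm_nonneg _

lemma opNorm_mul_le (m m' : Mat2) : opNorm (m * m') ≤ opNorm m * opNorm m' := by
  unfold opNorm
  rw [act_mul]
  exact ContinuousLinearMap.opNorm_comp_le _ _

lemma opNorm_sub_le (m m' : Mat2) : opNorm (m - m') ≤ opNorm m + opNorm m' := by
  unfold opNorm act
  rw [map_sub]
  exact norm_sub_le _ _

lemma opNorm_zero : opNorm 0 = 0 := by
  unfold opNorm act
  rw [map_zero, norm_zero]

lemma continuous_opNorm : Continuous opNorm := by
  let L : Mat2 →ₗ[ℝ] (Plane →L[ℝ] Plane) :=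
    { toFun := act
      map_add' := fun m m' => map_add (Matrix.toEuclideanCLM (n := Fin 2) (𝕜 := ℝ)) m m'
      map_smul' := fun c m => map_smul (Matrix.toEuclideanCLM (n := Fin 2) (𝕜 := ℝ)) c m }
  have h : Continuous (fun m : Mat2 => act m) := L.continuous_of_finiteDimensional
  exact h.norm

lemma abs_entry_le_opNorm (m : Mat2) (i j : Fin 2) : |m i j| ≤ opNorm m := by
  have h := (act m).le_opNorm (EuclideanSpace.single j (1 : ℝ))
  rw [PiLp.norm_single, norm_one, mul_one] at h
  refine le_trans ?_ h
  have h2 := PiLp.norm_apply_le (act m (EuclideanSpace.single j (1 : ℝ))) i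
  refine le_trans (le_of_eq ?_) h2
  rw [act_apply, Real.norm_eq_abs]
  fin_cases j <;> simp

/-- The constant is not sharp; multiplicative constants are invisible both to `(1/n) log` and to the
limits taken below. -/
lemma opNorm_le_of_entry_le {m : Mat2} {K : ℝ} (h : ∀ i j, |m i j| ≤ K) :
    opNorm m ≤ 4 * K := by
  have hK : 0 ≤ K := (abs_nonneg _).trans (h 0 0)
  refine ContinuousLinearMap.opNorm_le_bound _ (by positivity) fun v => ?_
  have hi : ∀ i, |act m v i| ≤ 2 * K * ‖v‖ := fun i => by
    rw [act_apply]
    have h0 : |v 0| ≤ ‖v‖ := PiLp.norm_apply_le v 0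
    have h1 : |v 1| ≤ ‖v‖ := PiLp.norm_apply_le v 1
    calc |m i 0 * v 0 + m i 1 * v 1| ≤ |m i 0| * |v 0| + |m i 1| * |v 1| := by
          rw [← abs_mul, ← abs_mul]; exact abs_add_le _ _
      _ ≤ K * ‖v‖ + K * ‖v‖ := by
          gcongr
          exacts [h i 0, h i 1]
      _ = 2 * K * ‖v‖ := by ring
  have hs := EuclideanSpace.norm_sq_eq (act m v)
  rw [Fin.sum_univ_two] at hs
  have h0 := hi 0
  have h1 := hi 1
  have hn := norm_nonneg (act m v)
  refine le_of_sq_le_sq ?_ (by positivity)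
  rw [hs, Real.norm_eq_abs, Real.norm_eq_abs]
  have := pow_le_pow_left₀ (abs_nonneg _) h0 2
  have := pow_le_pow_left₀ (abs_nonneg _) h1 2
  nlinarith [mul_nonneg hK (norm_nonneg v)]

/-- With determinant one the inverse is the adjugate, whose entries are those of `m` up to place and
sign. -/
lemma opNorm_inv_le (m : SL2) : opNorm (m⁻¹ : SL2) ≤ 4 * opNorm m := by
  refine opNorm_le_of_entry_le fun i j => ?_
  rw [Matrix.SpecialLinearGroup.coe_inv, Matrix.adjugate_fin_two]
  fin_cases i <;> fin_cases j <;> simp [abs_entry_le_opNorm]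

/-- Determinant one gives `1 ≤ 2‖m‖²`. This supplies the lower bound on `log ‖Cⁿ‖` for free, so that
zero exponents need only an upper bound. -/
lemma half_le_opNorm (m : SL2) : 1 / 2 ≤ opNorm m := by
  have hd := m.det_coe
  rw [Matrix.det_fin_two] at hd
  have h := abs_entry_le_opNorm (m : Mat2)
  have h1 : |(m : Mat2) 0 0 * (m : Mat2) 1 1| ≤ opNorm m * opNorm m := by
    rw [abs_mul]; exact mul_le_mul (h _ _) (h _ _) (abs_nonneg _) (opNorm_nonneg _)
  have h2 : |(m : Mat2) 0 1 * (m : Mat2) 1 0| ≤ opNorm m * opNorm m := by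
    rw [abs_mul]; exact mul_le_mul (h _ _) (h _ _) (abs_nonneg _) (opNorm_nonneg _)
  have h3 := (abs_le.mp h1).2
  have h4 := (abs_le.mp h2).1
  nlinarith [opNorm_nonneg (m : Mat2)]

lemma opNorm_pos (m : SL2) : 0 < opNorm m := lt_of_lt_of_le (by norm_num) (half_le_opNorm m)

/-! ### Monomial matrices -/

/-- The matrix is diagonal or antidiagonal, the nonzero entry of its first row has absolute value
`exp s`, and that of its second row `exp (-s)`. -/
def IsMonomial (s : ℝ) (m : SL2) : Prop :=
  ((m : Mat2) 0 1 = 0 ∧ (m : Mat2) 1 0 = 0 ∧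
    |(m : Mat2) 0 0| = Real.exp s ∧ |(m : Mat2) 1 1| = Real.exp (-s)) ∨
  ((m : Mat2) 0 0 = 0 ∧ (m : Mat2) 1 1 = 0 ∧
    |(m : Mat2) 0 1| = Real.exp s ∧ |(m : Mat2) 1 0| = Real.exp (-s))

lemma coe_diagSL {a : ℝ} (ha : 0 < a) : (diagSL a ha : Mat2) = !![a, 0; 0, a⁻¹] := rfl

lemma isMonomial_one : IsMonomial 0 1 := Or.inl (by simp)

/-- Left multiplication scales rows, so `s` is indexed by the row and the same rule covers both
shapes. -/
lemma IsMonomial.diagSL_mul {s a : ℝ} {m : SL2} (hm : IsMonomial s m) (ha : 0 < a) :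
    IsMonomial (s + Real.log a) (diagSL a ha * m) := by
  have e1 : Real.exp (s + Real.log a) = a * Real.exp s := by
    rw [Real.exp_add, Real.exp_log ha, mul_comm]
  have e2 : Real.exp (-(s + Real.log a)) = a⁻¹ * Real.exp (-s) := by
    rw [neg_add, Real.exp_add, Real.exp_neg (Real.log a), Real.exp_log ha, mul_comm]
  unfold IsMonomial
  rw [e1, e2]
  rcases hm with ⟨h1, h2, h3, h4⟩ | ⟨h1, h2, h3, h4⟩
  · left
    simp [coe_diagSL, Matrix.mul_apply, Fin.sum_univ_two, h1, h2, abs_mul, h3, h4, abs_of_pos ha]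
  · right
    simp [coe_diagSL, Matrix.mul_apply, Fin.sum_univ_two, h1, h2, abs_mul, h3, h4, abs_of_pos ha]

/-- Left multiplication by `q` exchanges the two rows, which reverses the sign of `s`; this reversal
is the source of all cancellation. The shift is `t = log |q₀₁|`, and `|q₁₀| = |q₀₁|⁻¹` by the
determinant. -/
lemma exists_isMonomial_of_antidiagonal {q : SL2} (h0 : (q : Mat2) 0 0 = 0)
    (h1 : (q : Mat2) 1 1 = 0) :
    ∃ t, ∀ s (m : SL2), IsMonomial s m → IsMonomial (-s + t) (q * m) := by
  have hd := q.det_coe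
  rw [Matrix.det_fin_two, h0, h1] at hd
  have hne : (q : Mat2) 0 1 ≠ 0 := by
    intro h; rw [h] at hd; norm_num at hd
  have hpos : 0 < |(q : Mat2) 0 1| := abs_pos.mpr hne
  have hq : |(q : Mat2) 1 0| = |(q : Mat2) 0 1|⁻¹ := by
    apply eq_inv_of_mul_eq_one_left
    rw [← abs_mul]
    have : (q : Mat2) 1 0 * (q : Mat2) 0 1 = -1 := by linarith
    rw [this]; norm_num
  refine ⟨Real.log |(q : Mat2) 0 1|, fun s m hm => ?_⟩
  have e1 : Real.exp (-s + Real.log |(q : Mat2) 0 1|) = |(q : Mat2) 0 1| * Real.exp (-s) := by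
    rw [Real.exp_add, Real.exp_log hpos, mul_comm]
  have e2 : Real.exp (-(-s + Real.log |(q : Mat2) 0 1|)) = |(q : Mat2) 1 0| * Real.exp s := by
    rw [neg_add, neg_neg, Real.exp_add, Real.exp_neg, Real.exp_log hpos, hq, mul_comm]
  unfold IsMonomial
  rw [e1, e2]
  rcases hm with ⟨h3, h4, h5, h6⟩ | ⟨h3, h4, h5, h6⟩
  · right
    simp [Matrix.mul_apply, Fin.sum_univ_two, h0, h1, abs_mul, h3, h4, h5, h6]
  · left
    simp [Matrix.mul_apply, Fin.sum_univ_two, h0, h1, abs_mul, h3, h4, h5, h6]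

lemma IsMonomial.opNorm_le {s : ℝ} {m : SL2} (hm : IsMonomial s m) :
    opNorm m ≤ 4 * Real.exp |s| := by
  have h1 : Real.exp s ≤ Real.exp |s| := Real.exp_le_exp.mpr (le_abs_self s)
  have h2 : Real.exp (-s) ≤ Real.exp |s| := Real.exp_le_exp.mpr (neg_le_abs s)
  have h0 : 0 ≤ Real.exp |s| := (Real.exp_pos _).le
  refine opNorm_le_of_entry_le fun i j => ?_
  rcases hm with ⟨h3, h4, h5, h6⟩ | ⟨h3, h4, h5, h6⟩ <;>
  fin_cases i <;> fin_cases j <;> simp [*]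

lemma IsMonomial.le_opNorm {s : ℝ} {m : SL2} (hm : IsMonomial s m) :
    Real.exp s ≤ opNorm m := by
  rcases hm with ⟨-, -, h, -⟩ | ⟨-, -, h, -⟩ <;> exact h ▸ abs_entry_le_opNorm _ _ _

/-! ### Exponents from logarithmic bounds -/

lemma isUpperExponent_of_bound {p : ℝ} {A : Cocycle} {l : ℝ} (K : ℝ) (S : ℕ → Shift2 → ℝ)
    (hS : ∀ᵐ x ∂(bernoulliMeasure p), Tendsto (fun n : ℕ => S n x / n) atTop (𝓝 l))
    (h : ∀ n x, |Real.log (opNorm (fwd A n x)) - S n x| ≤ K) : IsUpperExponent p A l := by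
  filter_upwards [hS] with x hx
  have h0 : Tendsto (fun n : ℕ => K / (n : ℝ)) atTop (𝓝 0) :=
    tendsto_const_div_atTop_nhds_zero_nat K
  have hd : Tendsto (fun n : ℕ => (Real.log (opNorm (fwd A n x)) - S n x) / n) atTop (𝓝 0) := by
    refine squeeze_zero_norm (fun n => ?_) h0
    rw [norm_div, Real.norm_eq_abs, Real.norm_natCast]
    gcongr
    exact h n x
  have := hd.add hx
  rw [zero_add] at this
  refine this.congr fun n => ?_
  change _ = 1 / (n : ℝ) * Real.log (opNorm (fwd A n x))
  ring

/-- The norms of a matrix in `SL(2, ℝ)` and of its inverse are comparable up to a factor 4, so the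
two exponents are opposite. -/
lemma isLowerExponent_of_isUpperExponent {p : ℝ} {A : Cocycle} {l : ℝ}
    (h : IsUpperExponent p A l) : IsLowerExponent p A (-l) := by
  filter_upwards [h] with x hx
  have h0 : Tendsto (fun n : ℕ => Real.log 4 / (n : ℝ)) atTop (𝓝 0) :=
    tendsto_const_div_atTop_nhds_zero_nat _
  have key : ∀ m : SL2, |Real.log (opNorm (m⁻¹ : SL2)) - Real.log (opNorm m)| ≤ Real.log 4 := by
    intro m
    have h1 := Real.log_le_log (opNorm_pos _) (opNorm_inv_le m)
    have h2 := Real.log_le_log (opNorm_pos _) (opNorm_inv_le m⁻¹)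
    rw [inv_inv] at h2
    rw [Real.log_mul (by norm_num) (opNorm_pos _).ne'] at h1 h2
    rw [abs_le]
    constructor <;> linarith
  have hd : Tendsto (fun n : ℕ => (Real.log (opNorm ((iter A n x)⁻¹ : SL2)) -
      Real.log (opNorm (iter A n x))) / n) atTop (𝓝 0) := by
    refine squeeze_zero_norm (fun n => ?_) h0
    rw [norm_div, Real.norm_eq_abs, Real.norm_natCast]
    gcongr
    exact key _
  have := (hd.add hx).neg
  rw [zero_add] at this
  refine this.congr fun n => ?_
  rw [Real.log_inv]
  ring

/-! ### Functions of finitely many coordinates -/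

lemma shift_pow_apply (n : ℕ) (x : Shift2) (j : ℤ) : (shift ^ n) x j = x (j + n) := by
  induction n generalizing j with
  | zero => simp
  | succ n ih =>
    rw [pow_succ', Equiv.Perm.mul_apply]
    change (shift ^ n) x (j + 1) = _
    rw [ih]; congr 1; push_cast; ring

lemma mem_shift_pow_image {S : Set Shift2} {n : ℕ} {x : Shift2} :
    x ∈ (shift ^ n : Equiv.Perm Shift2) '' S ↔ (fun j : ℤ => x (j - n)) ∈ S := by
  have h : ((shift ^ n : Equiv.Perm Shift2)) (fun j : ℤ => x (j - n)) = x := by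
    funext j; rw [shift_pow_apply]; simp
  constructor
  · rintro ⟨y, hy, rfl⟩
    convert hy using 1
    funext j; rw [shift_pow_apply]; simp
  · exact fun hx => ⟨_, hx, h⟩

/-- The coordinates of absolute value at most `m`. -/
def window (m : ℕ) : Set ℤ := {i | i.natAbs ≤ m}

lemma window_mono {m n : ℕ} (h : m ≤ n) : window m ⊆ window n := fun _ hi => le_trans hi h

lemma dependsOn_shift_pow {β : Type*} {F : Shift2 → β} {m : ℕ} (hF : DependsOn F (window m))
    (n : ℕ) : DependsOn (fun x => F ((shift ^ n) x)) (Icc ((n : ℤ) - m) (n + m)) := by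
  intro x y h
  refine hF fun i hi => ?_
  rw [shift_pow_apply, shift_pow_apply]
  refine h _ ?_
  have : i.natAbs ≤ m := hi
  constructor <;> omega

lemma dependsOn_mem_image {S : Set Shift2} {m : ℕ} (hS : DependsOn (· ∈ S) (window m)) (n : ℕ) :
    DependsOn (· ∈ (shift ^ n : Equiv.Perm Shift2) '' S) (window (m + n)) := by
  intro x y h
  simp only [mem_shift_pow_image]
  refine hS fun i hi => h _ ?_
  have : i.natAbs ≤ m := hi
  change (i - n).natAbs ≤ m + n
  omega

lemma dependsOn_mem_tower {S : Set Shift2} {m : ℕ} (hS : DependsOn (· ∈ S) (window m))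
    (a b : ℕ) : DependsOn (· ∈ tower S a b) (window (m + b)) := by
  intro x y h
  simp only [tower, mem_iUnion, Finset.mem_Ico, eq_iff_iff]
  refine exists_congr fun i => exists_congr fun hi => iff_of_eq ?_
  exact dependsOn_mem_image hS i fun j hj => h j (window_mono (by omega) hj)

lemma glue_of_mem {S : Set Shift2} {hS : IsClopen S} {A B : Cocycle} {x : Shift2} (hx : x ∈ S) :
    glue S hS A B x = A x := if_pos hx

lemma glue_of_notMem {S : Set Shift2} {hS : IsClopen S} {A B : Cocycle} {x : Shift2}
    (hx : x ∉ S) : glue S hS A B x = B x := if_neg hx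

lemma dependsOn_glue {S : Set Shift2} {hS : IsClopen S} {A B : Cocycle} {s : Set ℤ}
    (h : DependsOn (· ∈ S) s) (hA : DependsOn A s) (hB : DependsOn B s) :
    DependsOn (glue S hS A B) s := by
  intro x y hxy
  have hm : (x ∈ S) = (y ∈ S) := h hxy
  by_cases hx : x ∈ S
  · rw [glue_of_mem hx, glue_of_mem (hm ▸ hx), hA hxy]
  · rw [glue_of_notMem hx, glue_of_notMem (hm ▸ hx), hB hxy]

lemma dependsOn_mulConst {A : Cocycle} {s : Set ℤ} (hA : DependsOn A s) (g : SL2) :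
    DependsOn (mulConst A g) s := by
  intro x y hxy
  change A x * g = A y * g
  rw [hA hxy]

lemma dependsOn_cocA (σ : ℝ) (hσ : 1 < σ) : DependsOn (cocA σ hσ) (window 0) := by
  refine dependsOn_glue ?_ (fun _ _ _ => rfl) (fun _ _ _ => rfl)
  intro x y h
  have : x 0 = y 0 := h 0 (by simp [window])
  simp [this]

/-! ### The `δ`-log norm of functions of finitely many coordinates -/

/-- If `F x ≠ F y`, the points already differ at some coordinate of the window, so `d(x, y) ≥ ρ^m`
and `log (1/d) ≤ m log (1/ρ)`. Locality on scale `m` thus costs only `m^δ`, whereas a Hölder norm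
would cost an exponential in `m`. -/
lemma logNorm_le_of_dependsOn {ρ δ : ℝ} (hρ0 : 0 < ρ) (hρ1 : ρ < 1) (hδ : 0 < δ)
    {F : Shift2 → Mat2} {m : ℕ} (hF : DependsOn F (window m)) {K : ℝ}
    (hK : ∀ x, opNorm (F x) ≤ K) :
    logNorm ρ δ F ≤ ENNReal.ofReal (K * (1 + 2 * (m * Real.log (1 / ρ)) ^ δ)) := by
  have hK0 : 0 ≤ K := (opNorm_nonneg _).trans (hK 0)
  have hlog : 0 ≤ Real.log (1 / ρ) := Real.log_nonneg (by rw [le_div_iff₀ hρ0]; linarith)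
  have hpow : 0 ≤ (m * Real.log (1 / ρ)) ^ δ := by positivity
  have e : K * (1 + 2 * (m * Real.log (1 / ρ)) ^ δ) =
      K + 2 * K * (m * Real.log (1 / ρ)) ^ δ := by ring
  rw [e, ENNReal.ofReal_add hK0 (by positivity)]
  refine add_le_add (iSup_le fun x => ENNReal.ofReal_le_ofReal (hK x)) ?_
  refine iSup_le fun x => iSup_le fun y => iSup_le fun hxy => ENNReal.ofReal_le_ofReal ?_
  by_cases hFxy : F x = F y
  · rw [hFxy, sub_self, opNorm_zero, zero_mul]; positivity
  have hle : firstDiff x y ≤ m := by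
    by_contra hlt
    refine hFxy (hF fun i hi => ?_)
    by_contra hne
    have h1 : firstDiff x y ≤ i.natAbs := Nat.sInf_le ⟨i, rfl, hne⟩
    have h2 : i.natAbs ≤ m := hi
    omega
  have hd : Real.log (1 / dRho ρ x y) = firstDiff x y * Real.log (1 / ρ) := by
    rw [dRho, if_neg hxy, one_div, ← inv_pow, Real.log_pow, one_div]
  rw [hd]
  have h2 : opNorm (F x - F y) ≤ 2 * K :=
    (opNorm_sub_le _ _).trans (by linarith [hK x, hK y])
  have h3 : ((firstDiff x y : ℝ) * Real.log (1 / ρ)) ^ δ ≤ (m * Real.log (1 / ρ)) ^ δ := by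
    refine Real.rpow_le_rpow (by positivity) ?_ hδ.le
    gcongr
  exact mul_le_mul h2 h3 (by positivity) (by positivity)

lemma exists_opNorm_bound (A : Cocycle) : ∃ K, ∀ x, opNorm (A x) ≤ K := by
  have hc : Continuous fun x => opNorm (A x) :=
    continuous_opNorm.comp (continuous_subtype_val.comp A.continuous)
  obtain ⟨K, hK⟩ := (isCompact_range hc).bddAbove
  exact ⟨K, fun x => hK (mem_range_self x)⟩

lemma mem_CLog_of_dependsOn {ρ δ : ℝ} (hρ0 : 0 < ρ) (hρ1 : ρ < 1) (hδ : 0 < δ) {A : Cocycle}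
    {m : ℕ} (hA : DependsOn A (window m)) : A ∈ CLog ρ δ := by
  obtain ⟨K, hK⟩ := exists_opNorm_bound A
  refine lt_of_le_of_lt (logNorm_le_of_dependsOn hρ0 hρ1 hδ (m := m) (K := K) ?_ hK)
    ENNReal.ofReal_lt_top
  intro x y h
  change (A x : Mat2) = A y
  rw [hA h]

/-! ### Diagonal matrices and small perturbations of the diagonal cocycle. -/

lemma cocA_apply (σ : ℝ) (hσ : 1 < σ) (x : Shift2) :
    cocA σ hσ x = if x 0 = 1 then diagSL σ (one_pos.trans hσ) else 1 := by
  by_cases h : x 0 = 1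
  · rw [if_pos h]; exact glue_of_mem h
  · rw [if_neg h]; exact glue_of_notMem h

lemma diagSL_one : diagSL 1 one_pos = 1 := by
  apply Subtype.ext
  ext i j
  fin_cases i <;> fin_cases j <;> simp [diagSL]

lemma diagSL_mul {a b : ℝ} (ha : 0 < a) (hb : 0 < b) :
    diagSL a ha * diagSL b hb = diagSL (a * b) (mul_pos ha hb) := by
  apply Subtype.ext
  ext i j
  fin_cases i <;> fin_cases j <;>
    simp [coe_diagSL, Matrix.mul_apply, Fin.sum_univ_two, mul_comm]

lemma diagSL_pow {a : ℝ} (ha : 0 < a) (n : ℕ) :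
    diagSL a ha ^ n = diagSL (a ^ n) (pow_pos ha n) := by
  induction n with
  | zero => simp [diagSL_one]
  | succ n ih => rw [pow_succ, ih, diagSL_mul]; congr 1

lemma opNorm_cocA_le (σ : ℝ) (hσ : 1 < σ) (x : Shift2) : opNorm (cocA σ hσ x) ≤ 4 * σ := by
  refine opNorm_le_of_entry_le fun i j => ?_
  have h0 : 0 < σ := one_pos.trans hσ
  have h1 : σ⁻¹ ≤ σ := (inv_le_one_of_one_le₀ hσ.le).trans hσ.le
  rw [cocA_apply]
  split_ifs <;> fin_cases i <;> fin_cases j <;>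
    simp [coe_diagSL, abs_of_pos h0, h0.le, h1, hσ.le]

/-- Cocycles which differ from `cocA` by small right factors. -/
lemma logDist_cocA_le {ρ δ σ : ℝ} (hρ0 : 0 < ρ) (hρ1 : ρ < 1) (hδ : 0 < δ) (hσ : 1 < σ)
    {B : Cocycle} {m : ℕ} (hB : DependsOn B (window m)) {η : ℝ}
    (h : ∀ x, ∃ g : SL2, B x = cocA σ hσ x * g ∧ ∀ i j, |((g : Mat2) - 1) i j| ≤ η) :
    logDist ρ δ B (cocA σ hσ) ≤
      ENNReal.ofReal (16 * σ * η * (1 + 2 * (m * Real.log (1 / ρ)) ^ δ)) := by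
  refine logNorm_le_of_dependsOn hρ0 hρ1 hδ ?_ fun x => ?_
  · intro x y hxy
    simp only
    rw [hB hxy, dependsOn_cocA σ hσ fun i hi => hxy i (window_mono (Nat.zero_le _) hi)]
  · obtain ⟨g, hg, hη⟩ := h x
    have e : (B x : Mat2) - cocA σ hσ x = cocA σ hσ x * ((g : Mat2) - 1) := by
      rw [hg, Matrix.SpecialLinearGroup.coe_mul, mul_sub, mul_one]
    rw [e]
    calc opNorm ((cocA σ hσ x : Mat2) * ((g : Mat2) - 1))
        ≤ opNorm (cocA σ hσ x) * opNorm ((g : Mat2) - 1) := opNorm_mul_le _ _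
      _ ≤ (4 * σ) * (4 * η) := by
          refine mul_le_mul (opNorm_cocA_le σ hσ x) (opNorm_le_of_entry_le hη)
            (opNorm_nonneg _) (by linarith)
      _ = 16 * σ * η := by ring

/-- Common criterion for both families: windows of size `O(k)` and right factors within `η k` of the
identity, entry by entry, with `η k = o(k^{-δ})`. -/
lemma tendsto_logDist_cocA {ρ δ σ : ℝ} (hρ0 : 0 < ρ) (hρ1 : ρ < 1) (hδ : 0 < δ) (hσ : 1 < σ)
    {B : ℕ → Cocycle} {c : ℕ} (hB : ∀ᶠ k in atTop, DependsOn (B k) (window (c * k))) {η : ℕ → ℝ}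
    (h : ∀ᶠ k in atTop, ∀ x, ∃ g : SL2, B k x = cocA σ hσ x * g ∧
      ∀ i j, |((g : Mat2) - 1) i j| ≤ η k)
    (hη0 : Tendsto (fun k => η k * (k : ℝ) ^ δ) atTop (𝓝 0)) :
    Tendsto (fun k => logDist ρ δ (B k) (cocA σ hσ)) atTop (𝓝 0) := by
  have hlog : 0 ≤ Real.log (1 / ρ) := Real.log_nonneg (by rw [le_div_iff₀ hρ0]; linarith)
  have hη : Tendsto η atTop (𝓝 0) := by
    refine squeeze_zero_norm' ?_ (hη0.norm.trans_eq (by rw [norm_zero]))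
    filter_upwards [eventually_ge_atTop 1] with k hk
    rw [norm_mul]
    refine le_mul_of_one_le_right (norm_nonneg _) ?_
    have : (1 : ℝ) ≤ (k : ℝ) ^ δ := Real.one_le_rpow (by exact_mod_cast hk) hδ.le
    rw [Real.norm_eq_abs]
    exact this.trans (le_abs_self _)
  have hlim : Tendsto (fun k : ℕ => 16 * σ * η k *
      (1 + 2 * (((c * k : ℕ) : ℝ) * Real.log (1 / ρ)) ^ δ)) atTop (𝓝 0) := by
    have h1 := (hη.const_mul (16 * σ)).add
      (hη0.const_mul (16 * σ * (2 * ((c : ℝ) * Real.log (1 / ρ)) ^ δ)))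
    rw [mul_zero, mul_zero, add_zero] at h1
    refine h1.congr fun k => ?_
    have : (((c * k : ℕ) : ℝ) * Real.log (1 / ρ)) ^ δ =
        ((c : ℝ) * Real.log (1 / ρ)) ^ δ * (k : ℝ) ^ δ := by
      rw [← Real.mul_rpow (by positivity) (by positivity)]
      congr 1; push_cast; ring
    rw [this]; ring
  have hlim' := ENNReal.tendsto_ofReal hlim
  rw [ENNReal.ofReal_zero] at hlim'
  refine tendsto_of_tendsto_of_tendsto_of_le_of_le' tendsto_const_nhds hlim'
    (Eventually.of_forall fun _ => zero_le) ?_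
  filter_upwards [h, hB] with k hk hBk
  exact logDist_cocA_le hρ0 hρ1 hδ hσ hBk hk

/-! ### Coordinate axes -/

lemma act_single_apply (m : Mat2) (i j : Fin 2) :
    act m (EuclideanSpace.single i (1 : ℝ)) j = m j i := by
  rw [act_apply]
  fin_cases i <;> simp

lemma map_axis {m : Mat2} {i j l : Fin 2} (hjl : j ≠ l) (h0 : m l i = 0) (h1 : m j i ≠ 0) :
    (axis i).map (act m).toLinearMap = axis j := by
  have h : act m (EuclideanSpace.single i (1 : ℝ)) =
      m j i • EuclideanSpace.single j (1 : ℝ) := by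
    ext a
    rw [act_single_apply]
    rcases eq_or_ne a j with rfl | ha
    · simp
    · have : a = l := by omega
      subst this
      simp [h0, ha]
  unfold axis
  rw [Submodule.map_span, image_singleton]
  change Submodule.span ℝ {act m (EuclideanSpace.single i (1 : ℝ))} = _
  rw [h]
  exact Submodule.span_singleton_smul_eq (IsUnit.mk0 _ h1) _

lemma map_axis_of_diagonal {m : SL2} (h01 : (m : Mat2) 0 1 = 0) (h10 : (m : Mat2) 1 0 = 0)
    (i : Fin 2) : (axis i).map (act m).toLinearMap = axis i := by
  have hd := m.det_coe
  rw [Matrix.det_fin_two, h01, zero_mul, sub_zero] at hd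
  fin_cases i
  · exact map_axis (l := 1) (by simp) h10 (left_ne_zero_of_mul_eq_one hd)
  · exact map_axis (l := 0) (by simp) h01 (right_ne_zero_of_mul_eq_one hd)

lemma swapsAxes_of_antidiagonal {m : SL2} (h00 : (m : Mat2) 0 0 = 0) (h11 : (m : Mat2) 1 1 = 0) :
    SwapsAxes m := by
  have hd := m.det_coe
  rw [Matrix.det_fin_two, h00, zero_mul, zero_sub, ← neg_mul] at hd
  have h01 : (m : Mat2) 0 1 ≠ 0 := by
    intro h; simp [h] at hd
  have h10 : (m : Mat2) 1 0 ≠ 0 := by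
    intro h; simp [h] at hd
  exact ⟨map_axis (l := 0) (by simp) h00 h10, map_axis (l := 1) (by simp) h11 h01⟩

lemma mem_axis {v : Plane} {i : Fin 2} : v ∈ axis i ↔ ∃ c : ℝ, v = EuclideanSpace.single i c := by
  unfold axis
  rw [Submodule.mem_span_singleton]
  refine exists_congr fun c => ?_
  have : c • EuclideanSpace.single i (1 : ℝ) = EuclideanSpace.single i c := by
    ext a; simp
  rw [this, eq_comm]

lemma isCompl_axis : IsCompl (axis 1) (axis 0) := by
  constructor
  · rw [Submodule.disjoint_def]
    intro v h1 h0
    obtain ⟨a, rfl⟩ := mem_axis.mp h1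
    obtain ⟨b, hb⟩ := mem_axis.mp h0
    have h := congrArg (fun v : Plane => v 1) hb
    simp at h
    rw [h]; ext i; simp
  · rw [codisjoint_iff, eq_top_iff]
    intro v _
    rw [Submodule.mem_sup]
    refine ⟨EuclideanSpace.single 1 (v 1), mem_axis.mpr ⟨_, rfl⟩,
      EuclideanSpace.single 0 (v 0), mem_axis.mpr ⟨_, rfl⟩, ?_⟩
    ext i
    fin_cases i <;> simp

lemma finrank_axis (i : Fin 2) : Module.finrank ℝ (axis i) = 1 :=
  finrank_span_singleton (by simp)

lemma norm_act_of_mem_axis {m : Mat2} {i l : Fin 2} (hil : i ≠ l) (h0 : m l i = 0) {v : Plane}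
    (hv : v ∈ axis i) : ‖act m v‖ = |m i i| * ‖v‖ := by
  obtain ⟨c, rfl⟩ := mem_axis.mp hv
  have h : act m (EuclideanSpace.single i c) = EuclideanSpace.single i (m i i * c) := by
    ext a
    have hs : act m (EuclideanSpace.single i c) a = m a i * c := by
      rw [act_apply]; fin_cases i <;> simp
    rw [hs]
    rcases eq_or_ne a i with rfl | ha
    · simp
    · have : a = l := by omega
      subst this
      simp [h0, ha]
  rw [h]
  simp

/-! ### Uniformly hyperbolic diagonal cocycles -/

lemma uniformlyHyperbolic_of_diagonal {A : Cocycle} {c : ℝ} (hc : 1 < c)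
    (hA : ∀ x, ∃ (a : ℝ) (ha : 0 < a), c ≤ a ∧ A x = diagSL a ha) : UniformlyHyperbolic A := by
  have c0 : 0 < c := one_pos.trans hc
  have hfwd : ∀ n x, ∃ (a : ℝ) (ha : 0 < a), c ^ n ≤ a ∧ fwd A n x = diagSL a ha := by
    intro n x
    induction n with
    | zero => exact ⟨1, one_pos, by simp, diagSL_one.symm⟩
    | succ n ih =>
      obtain ⟨a, ha, hca, e⟩ := ih
      obtain ⟨b, hb, hcb, e'⟩ := hA ((shift ^ n) x)
      refine ⟨b * a, mul_pos hb ha, ?_, ?_⟩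
      · rw [pow_succ']; exact mul_le_mul hcb hca (by positivity) hb.le
      · change A ((shift ^ n) x) * fwd A n x = _
        rw [e, e', diagSL_mul]
  have hinv : ∀ {n : ℕ} {a : ℝ} (ha : 0 < a), c ^ n ≤ a → |a⁻¹| ≤ 1 * c⁻¹ ^ n := by
    intro n a ha h
    rw [abs_of_pos (inv_pos.mpr ha), one_mul, inv_pow]
    exact inv_anti₀ (by positivity) h
  refine ⟨fun _ => axis 1, fun _ => axis 0, 1, c⁻¹, one_pos, inv_pos.mpr c0,
    inv_lt_one_of_one_lt₀ hc, fun x => ⟨finrank_axis 1, finrank_axis 0, isCompl_axis, ?_, ?_, ?_, ?_⟩⟩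
  · obtain ⟨a, ha, -, e⟩ := hA x
    rw [e]; exact map_axis_of_diagonal (by simp [coe_diagSL]) (by simp [coe_diagSL]) 1
  · obtain ⟨a, ha, -, e⟩ := hA x
    rw [e]; exact map_axis_of_diagonal (by simp [coe_diagSL]) (by simp [coe_diagSL]) 0
  · intro n v hv
    obtain ⟨a, ha, hca, e⟩ := hfwd n x
    change ‖act (fwd A n x) v‖ ≤ _
    rw [e, norm_act_of_mem_axis (l := 0) (by simp) (by simp [coe_diagSL]) hv]
    refine mul_le_mul_of_nonneg_right ?_ (norm_nonneg v)
    exact hinv ha hca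
  · intro n v hv
    -- The base point of the inverse product is irrelevant, since the bound on the iterates is
    -- uniform in the point.
    have key : ∃ y, iter A (-(n : ℤ)) x = (fwd A n y)⁻¹ := by
      cases n with
      | zero => exact ⟨x, by simp [fwd, iter]⟩
      | succ n => exact ⟨_, rfl⟩
    obtain ⟨y, hy⟩ := key
    obtain ⟨a, ha, hca, e⟩ := hfwd n y
    rw [hy, e, norm_act_of_mem_axis (l := 1) (by simp) (by
      rw [Matrix.SpecialLinearGroup.coe_inv, Matrix.adjugate_fin_two]; simp [coe_diagSL]) hv]
    refine mul_le_mul_of_nonneg_right ?_ (norm_nonneg v)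
    rw [Matrix.SpecialLinearGroup.coe_inv, Matrix.adjugate_fin_two]
    exact hinv ha hca

lemma continuous_diagSL_exp : Continuous fun t : ℝ => diagSL (Real.exp t) (Real.exp_pos t) := by
  refine Continuous.subtype_mk (continuous_matrix fun i j => ?_) _
  fin_cases i <;> fin_cases j <;> simp <;> fun_prop (disch := simp)

lemma continuous_mulConst (A : Cocycle) : Continuous (mulConst A) := by
  let F : C(SL2 × Shift2, SL2) := ⟨fun q => A q.2 * q.1, by fun_prop⟩
  exact F.curry.continuous

/-- Composing with `diag(e^t, e^{-t})` turns the identity values into expansion of the first axis by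
`e^t`, and the other values expand it even more. Let `t → 0⁺`. -/
lemma cocA_mem_closure_UH (σ : ℝ) (hσ : 1 < σ) : cocA σ hσ ∈ closure UH := by
  have hc : Continuous fun t : ℝ =>
      mulConst (cocA σ hσ) (diagSL (Real.exp t) (Real.exp_pos t)) :=
    (continuous_mulConst _).comp continuous_diagSL_exp
  have h0 : mulConst (cocA σ hσ) (diagSL (Real.exp 0) (Real.exp_pos 0)) = cocA σ hσ := by
    have h1 : diagSL (Real.exp 0) (Real.exp_pos 0) = 1 := by
      rw [← diagSL_one]; congr 1; exact Real.exp_zero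
    ext1 x
    change cocA σ hσ x * _ = _
    rw [h1, mul_one]
  have ht : Tendsto (fun t : ℝ => mulConst (cocA σ hσ) (diagSL (Real.exp t) (Real.exp_pos t)))
      (𝓝[>] 0) (𝓝 (cocA σ hσ)) := by
    have := (hc.tendsto 0).mono_left (nhdsWithin_le_nhds (s := Ioi (0 : ℝ)))
    rwa [h0] at this
  refine mem_closure_of_tendsto ht ?_
  filter_upwards [self_mem_nhdsWithin] with t (ht0 : 0 < t)
  refine uniformlyHyperbolic_of_diagonal (c := Real.exp t) (Real.one_lt_exp_iff.mpr ht0) fun x => ?_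
  change ∃ (a : ℝ) (ha : 0 < a), Real.exp t ≤ a ∧ cocA σ hσ x * _ = _
  rw [cocA_apply]
  split_ifs
  · exact ⟨_, mul_pos (one_pos.trans hσ) (Real.exp_pos t),
      le_mul_of_one_le_left (Real.exp_pos t).le hσ.le, diagSL_mul _ _⟩
  · exact ⟨_, Real.exp_pos t, le_rfl, one_mul _⟩

/-- Over the fixed point `0^∞` all iterates are the identity, so no line is contracted. -/
lemma cocA_notMem_UH (σ : ℝ) (hσ : 1 < σ) : cocA σ hσ ∉ UH := by
  rintro ⟨Es, Eu, C, r, hC, hr0, hr1, h⟩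
  obtain ⟨hs, -, -, -, -, hcon, -⟩ := h 0
  have hfwd : ∀ n, fwd (cocA σ hσ) n 0 = 1 := by
    intro n
    induction n with
    | zero => rfl
    | succ n ih =>
      change cocA σ hσ ((shift ^ n) 0) * fwd (cocA σ hσ) n 0 = 1
      rw [ih, cocA_apply, shift_pow_apply]
      simp
  have : Nontrivial (Es 0) := Module.nontrivial_of_finrank_pos (R := ℝ) (by omega)
  obtain ⟨⟨v, hv⟩, hv0⟩ := exists_ne (0 : Es 0)
  have hvpos : 0 < ‖v‖ := norm_pos_iff.mpr fun hh => hv0 (by simp [hh])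
  have hlim : Tendsto (fun n : ℕ => C * r ^ n * ‖v‖) atTop (𝓝 0) := by
    have := ((tendsto_pow_atTop_nhds_zero_of_lt_one hr0.le hr1).const_mul C).mul_const ‖v‖
    simpa using this
  have hge : ∀ n : ℕ, ‖v‖ ≤ C * r ^ n * ‖v‖ := by
    intro n
    have h1 := hcon n v hv
    change ‖act (fwd (cocA σ hσ) n 0 : SL2) v‖ ≤ _ at h1
    rw [hfwd, Matrix.SpecialLinearGroup.coe_one, act_one] at h1
    exact h1
  exact absurd (ge_of_tendsto' hlim hge) (not_le.mpr hvpos)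

lemma cocA_mem_frontier_UH (σ : ℝ) (hσ : 1 < σ) : cocA σ hσ ∈ frontier UH :=
  ⟨cocA_mem_closure_UH σ hσ, fun h => cocA_notMem_UH σ hσ (interior_subset h)⟩

lemma map_axis_cocA (σ : ℝ) (hσ : 1 < σ) (x : Shift2) (i : Fin 2) :
    (axis i).map (act (cocA σ hσ x)).toLinearMap = axis i := by
  rw [cocA_apply]
  split_ifs
  · exact map_axis_of_diagonal (by simp [coe_diagSL]) (by simp [coe_diagSL]) i
  · exact map_axis_of_diagonal (by simp) (by simp) i

/-! ### The Bernoulli measure -/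

lemma isProbabilityMeasure_coin {p : ℝ} (hp0 : 0 ≤ p) (hp1 : p ≤ 1) :
    IsProbabilityMeasure (coin p) := by
  constructor
  simp only [coin, Measure.coe_add, Measure.coe_smul, Pi.add_apply, Pi.smul_apply, measure_univ,
    smul_eq_mul, mul_one]
  rw [← ENNReal.ofReal_add hp0 (by linarith)]
  simp

lemma isProbabilityMeasure_bernoulliMeasure {p : ℝ} (hp0 : 0 ≤ p) (hp1 : p ≤ 1) :
    IsProbabilityMeasure (bernoulliMeasure p) := by
  have := isProbabilityMeasure_coin hp0 hp1
  unfold bernoulliMeasure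
  infer_instance

lemma coin_one (p : ℝ) : coin p {1} = ENNReal.ofReal p := by
  simp [coin]

lemma coin_zero (p : ℝ) : coin p {0} = ENNReal.ofReal (1 - p) := by
  simp [coin]

lemma iIndepFun_coord {p : ℝ} (hp0 : 0 ≤ p) (hp1 : p ≤ 1) :
    ProbabilityTheory.iIndepFun (fun (i : ℤ) (x : Shift2) => x i) (bernoulliMeasure p) := by
  have := isProbabilityMeasure_coin hp0 hp1
  exact ProbabilityTheory.iIndepFun_infinitePi (P := fun _ : ℤ => coin p)
    (X := fun _ a => a) fun _ => measurable_id

lemma map_coord_bernoulliMeasure {p : ℝ} (hp0 : 0 ≤ p) (hp1 : p ≤ 1) (i : ℤ) :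
    (bernoulliMeasure p).map (fun x => x i) = coin p := by
  have := isProbabilityMeasure_coin hp0 hp1
  exact Measure.infinitePi_map_eval (fun _ : ℤ => coin p) i

/-- The function factors through the finite set of configurations on `s`, where everything is
measurable. -/
lemma measurable_of_dependsOn {β : Type*} [MeasurableSpace β] {F : Shift2 → β} {s : Set ℤ}
    (hs : s.Finite) (hF : DependsOn F s) : Measurable F := by
  have : Finite s := hs
  have : Nonempty β := ⟨F 0⟩
  obtain ⟨g, rfl⟩ := dependsOn_iff_exists_comp.mp hF
  exact (measurable_of_countable g).comp
    (measurable_pi_iff.mpr fun i => measurable_pi_apply (i : ℤ))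

lemma measurableSet_of_dependsOn {A : Set Shift2} {s : Set ℤ}
    (hs : s.Finite) (hA : DependsOn (· ∈ A) s) : MeasurableSet A :=
  measurableSet_setOfPred.mpr (measurable_of_dependsOn hs hA)

lemma bernoulliMeasure_inter {p : ℝ} (hp0 : 0 ≤ p) (hp1 : p ≤ 1) {A B : Set Shift2}
    {S T : Finset ℤ} (hA : DependsOn (· ∈ A) S) (hB : DependsOn (· ∈ B) T)
    (hST : Disjoint S T) :
    bernoulliMeasure p (A ∩ B) = bernoulliMeasure p A * bernoulliMeasure p B := by
  have hI := (iIndepFun_coord hp0 hp1).indepFun_finset S T hST measurable_pi_apply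
  obtain ⟨a, ha⟩ := dependsOn_iff_exists_comp.mp hA
  obtain ⟨b, hb⟩ := dependsOn_iff_exists_comp.mp hB
  have hA' : A = (fun (x : Shift2) (i : S) => x i) ⁻¹' {u | a u} := by
    ext x; exact iff_of_eq (congrFun ha x)
  have hB' : B = (fun (x : Shift2) (i : T) => x i) ⁻¹' {u | b u} := by
    ext x; exact iff_of_eq (congrFun hb x)
  rw [hA', hB']
  exact hI.measure_inter_preimage_eq_mul _ _ (toFinite _).measurableSet (toFinite _).measurableSet

/-! ### Exponents of the diagonal cocycle -/

lemma ae_tendsto_frequency {p : ℝ} (hp0 : 0 ≤ p) (hp1 : p ≤ 1) :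
    ∀ᵐ x ∂(bernoulliMeasure p), Tendsto (fun n : ℕ =>
      (∑ j ∈ Finset.range n, if x (j : ℤ) = 1 then (1 : ℝ) else 0) / n) atTop (𝓝 p) := by
  have := isProbabilityMeasure_coin hp0 hp1
  have := isProbabilityMeasure_bernoulliMeasure hp0 hp1
  let e : Fin 2 → ℝ := fun a => if a = 1 then 1 else 0
  have he : Measurable e := measurable_of_finite e
  have hmap := map_coord_bernoulliMeasure hp0 hp1
  have hlaw := ProbabilityTheory.strong_law_ae_real (μ := bernoulliMeasure p)
    (fun (j : ℕ) (x : Shift2) => e (x (j : ℤ))) ?_ ?_ ?_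
  · have hint : ∫ x, e (x ((0 : ℕ) : ℤ)) ∂(bernoulliMeasure p) = p := by
      rw [← integral_map (φ := fun x : Shift2 => x ((0 : ℕ) : ℤ))
        (measurable_pi_apply _).aemeasurable he.aestronglyMeasurable, hmap]
      have h0 : Integrable e (ENNReal.ofReal p • Measure.dirac 1) :=
        (integrable_dirac (by simp)).smul_measure ENNReal.ofReal_ne_top
      have h1 : Integrable e (ENNReal.ofReal (1 - p) • Measure.dirac 0) :=
        (integrable_dirac (by simp)).smul_measure ENNReal.ofReal_ne_top
      rw [coin, integral_add_measure h0 h1]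
      simp [e, hp0]
    rw [hint] at hlaw
    exact hlaw
  · refine Integrable.of_bound (C := 1)
      (he.comp (measurable_pi_apply ((0 : ℕ) : ℤ))).aestronglyMeasurable (ae_of_all _ fun x => ?_)
    simp only [e]
    split_ifs <;> simp
  · intro i j hij
    exact ((iIndepFun_coord hp0 hp1).indepFun (i := (i : ℤ)) (j := (j : ℤ))
      (by exact_mod_cast hij)).comp he he
  · intro i
    refine ProbabilityTheory.IdentDistrib.comp (u := e) ⟨(measurable_pi_apply _).aemeasurable,
      (measurable_pi_apply _).aemeasurable, ?_⟩ he
    rw [hmap, hmap]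

lemma isMonomial_fwd_cocA (σ : ℝ) (hσ : 1 < σ) (n : ℕ) (x : Shift2) :
    IsMonomial ((∑ j ∈ Finset.range n, if x (j : ℤ) = 1 then (1 : ℝ) else 0) * Real.log σ)
      (fwd (cocA σ hσ) n x) := by
  induction n with
  | zero =>
    rw [Finset.range_zero, Finset.sum_empty, zero_mul]
    exact isMonomial_one
  | succ n ih =>
    rw [Finset.sum_range_succ, add_mul]
    change IsMonomial _ (cocA σ hσ ((shift ^ n) x) * fwd (cocA σ hσ) n x)
    rw [cocA_apply, shift_pow_apply, zero_add]
    split_ifs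
    · rw [one_mul]; exact ih.diagSL_mul _
    · rw [zero_mul, add_zero, one_mul]; exact ih

lemma isUpperExponent_cocA {p σ : ℝ} (hp0 : 0 ≤ p) (hp1 : p ≤ 1) (hσ : 1 < σ) :
    IsUpperExponent p (cocA σ hσ) (p * Real.log σ) := by
  refine isUpperExponent_of_bound (Real.log 4)
    (fun n x => (∑ j ∈ Finset.range n, if x (j : ℤ) = 1 then (1 : ℝ) else 0) * Real.log σ) ?_ ?_
  · filter_upwards [ae_tendsto_frequency hp0 hp1] with x hx
    refine (hx.mul_const (Real.log σ)).congr fun n => ?_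
    ring
  · intro n x
    have hm := isMonomial_fwd_cocA σ hσ n x
    set s := (∑ j ∈ Finset.range n, if x (j : ℤ) = 1 then (1 : ℝ) else 0) * Real.log σ
    have hs : 0 ≤ s := by
      refine mul_nonneg (Finset.sum_nonneg fun j _ => ?_) (Real.log_nonneg hσ.le)
      split_ifs <;> norm_num
    have h1 := Real.log_le_log (Real.exp_pos s) hm.le_opNorm
    have h2 := Real.log_le_log (opNorm_pos _) hm.opNorm_le
    rw [Real.log_exp] at h1
    rw [Real.log_mul (by norm_num) (Real.exp_pos _).ne', Real.log_exp, abs_of_nonneg hs] at h2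
    have h4 : 0 ≤ Real.log 4 := Real.log_nonneg (by norm_num)
    rw [abs_le]
    constructor <;> linarith

/-! ### Uniqueness of exponents and the discontinuity criterion. -/

lemma IsUpperExponent.unique {p : ℝ} (hp0 : 0 ≤ p) (hp1 : p ≤ 1) {A : Cocycle} {l l' : ℝ}
    (h : IsUpperExponent p A l) (h' : IsUpperExponent p A l') : l = l' := by
  have := isProbabilityMeasure_bernoulliMeasure hp0 hp1
  obtain ⟨x, hx, hx'⟩ := (h.and h').exists
  exact tendsto_nhds_unique hx hx'

lemma IsLowerExponent.unique {p : ℝ} (hp0 : 0 ≤ p) (hp1 : p ≤ 1) {A : Cocycle} {l l' : ℝ}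
    (h : IsLowerExponent p A l) (h' : IsLowerExponent p A l') : l = l' := by
  have := isProbabilityMeasure_bernoulliMeasure hp0 hp1
  obtain ⟨x, hx, hx'⟩ := (h.and h').exists
  exact tendsto_nhds_unique hx hx'

lemma IsUpperExponent.upperExponent_eq {p : ℝ} (hp0 : 0 ≤ p) (hp1 : p ≤ 1) {A : Cocycle} {l : ℝ}
    (h : IsUpperExponent p A l) : upperExponent p A = l := by
  have hex : ∃ l, IsUpperExponent p A l := ⟨l, h⟩
  rw [upperExponent, dif_pos hex]
  exact hex.choose_spec.unique hp0 hp1 h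

lemma IsLowerExponent.lowerExponent_eq {p : ℝ} (hp0 : 0 ≤ p) (hp1 : p ≤ 1) {A : Cocycle} {l : ℝ}
    (h : IsLowerExponent p A l) : lowerExponent p A = l := by
  have hex : ∃ l, IsLowerExponent p A l := ⟨l, h⟩
  rw [lowerExponent, dif_pos hex]
  exact hex.choose_spec.unique hp0 hp1 h

lemma not_logContinuousAt {ρ δ l : ℝ} {Φ : Cocycle → ℝ} {A : Cocycle} (hA : Φ A = l) (hl : l ≠ 0)
    (h : ∀ ε : ℝ≥0∞, 0 < ε → ∃ B ∈ CLog ρ δ, logDist ρ δ B A < ε ∧ Φ B = 0) :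
    ¬ LogContinuousAt ρ δ Φ A := by
  intro hc
  obtain ⟨η, hη, hcont⟩ := hc |l| (abs_pos.mpr hl)
  obtain ⟨B, hB, hd, h0⟩ := h η hη
  have := hcont B hB hd
  rw [h0, hA, zero_sub, abs_neg] at this
  exact lt_irrefl _ this

/-! ### A law of large numbers for weakly correlated bounded variables -/

/-- Every `n` lies at most `2k` above `k²`, where `k` is its integer square root; there `s` moves by
at most `2Kk`, which is negligible against `k²`. -/
lemma tendsto_div_of_tendsto_sq {s : ℕ → ℝ} {K : ℝ} (hK : ∀ n, |s (n + 1) - s n| ≤ K)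
    (h : Tendsto (fun k : ℕ => s (k ^ 2) / (k : ℝ) ^ 2) atTop (𝓝 0)) :
    Tendsto (fun n : ℕ => s n / n) atTop (𝓝 0) := by
  have hK0 : 0 ≤ K := (abs_nonneg _).trans (hK 0)
  have hinc : ∀ n m, |s (n + m) - s n| ≤ K * m := by
    intro n m
    induction m with
    | zero => simp
    | succ m ih =>
      have e : s (n + (m + 1)) - s n = (s (n + m + 1) - s (n + m)) + (s (n + m) - s n) := by
        rw [← add_assoc]; ring
      rw [e]
      refine (abs_add_le _ _).trans ?_
      push_cast
      linarith [hK (n + m)]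
  have hsqrt : Tendsto Nat.sqrt atTop atTop :=
    tendsto_atTop_atTop.mpr fun b => ⟨b * b, fun n hn => Nat.le_sqrt.mpr hn⟩
  have hlim : Tendsto (fun k : ℕ => |s (k ^ 2) / (k : ℝ) ^ 2| + 2 * K / k) atTop (𝓝 0) := by
    have := h.abs.add (tendsto_const_div_atTop_nhds_zero_nat (2 * K))
    simpa using this
  refine squeeze_zero_norm' ?_ (hlim.comp hsqrt)
  filter_upwards [eventually_ge_atTop 1] with n hn
  change ‖s n / n‖ ≤ |s (Nat.sqrt n ^ 2) / (Nat.sqrt n : ℝ) ^ 2| + 2 * K / Nat.sqrt n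
  obtain ⟨k, hk⟩ : ∃ k, Nat.sqrt n = k := ⟨_, rfl⟩
  rw [hk]
  have hk1 : 1 ≤ k := hk ▸ Nat.le_sqrt.mpr (by omega)
  have hkn : k ^ 2 ≤ n := hk ▸ Nat.sqrt_le' n
  have hkn' : n ≤ k ^ 2 + 2 * k := by
    have := Nat.sqrt_le_add n
    rw [hk] at this
    nlinarith
  clear hk
  obtain ⟨m, rfl⟩ := Nat.exists_eq_add_of_le hkn
  have hm : (m : ℝ) ≤ 2 * k := by exact_mod_cast (by omega : m ≤ 2 * k)
  have hk0 : (0 : ℝ) < k := by exact_mod_cast hk1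
  have hden : ((k : ℝ) ^ 2) ≤ ((k ^ 2 + m : ℕ) : ℝ) := by exact_mod_cast hkn
  have h1 : |s (k ^ 2 + m)| ≤ |s (k ^ 2)| + 2 * K * k := by
    have h2 := hinc (k ^ 2) m
    have h3 : |s (k ^ 2 + m)| ≤ |s (k ^ 2 + m) - s (k ^ 2)| + |s (k ^ 2)| := by
      have := abs_add_le (s (k ^ 2 + m) - s (k ^ 2)) (s (k ^ 2))
      rwa [sub_add_cancel] at this
    nlinarith
  rw [norm_div, Real.norm_eq_abs, Real.norm_natCast]
  calc |s (k ^ 2 + m)| / ((k ^ 2 + m : ℕ) : ℝ) ≤ (|s (k ^ 2)| + 2 * K * k) / (k : ℝ) ^ 2 := by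
        gcongr
    _ = |s (k ^ 2) / (k : ℝ) ^ 2| + 2 * K / k := by
        rw [abs_div, abs_of_pos (pow_pos hk0 2), add_div]
        congr 1
        field_simp

lemma sum_le_tsum_of_injOn {a : ℕ → ℝ} (ha : Summable a) (ha0 : ∀ n, 0 ≤ a n) (s : Finset ℕ)
    {e : ℕ → ℕ} (he : InjOn e s) : ∑ j ∈ s, a (e j) ≤ ∑' n, a n := by
  classical
  rw [← Finset.sum_image (f := a) he]
  exact ha.sum_le_tsum _ fun _ _ => ha0 _

section Correlation

variable {Ω : Type*} [MeasurableSpace Ω]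

/-- Expanding the square gives `n` rows of correlations. In each row the terms on either side of the
diagonal have distinct lags, so each side is at most `∑ a d`. -/
lemma integral_sq_sum_le {μ : Measure Ω} [IsProbabilityMeasure μ] {c : ℕ → Ω → ℝ}
    (hm : ∀ n, Measurable (c n)) {K : ℝ} (hK : ∀ n ω, |c n ω| ≤ K) {a : ℕ → ℝ}
    (ha : Summable a) (ha0 : ∀ n, 0 ≤ a n)
    (hcorr : ∀ i d, |∫ ω, c i ω * c (i + d) ω ∂μ| ≤ a d) (n : ℕ) :
    ∫ ω, (∑ i ∈ Finset.range n, c i ω) ^ 2 ∂μ ≤ n * (2 * ∑' d, a d) := by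
  have hint : ∀ i j, Integrable (fun ω => c i ω * c j ω) μ := fun i j => by
    refine Integrable.of_bound (C := K * K) ((hm i).mul (hm j)).aestronglyMeasurable
      (ae_of_all _ fun ω => ?_)
    rw [norm_mul]
    exact mul_le_mul (hK i ω) (hK j ω) (norm_nonneg _) ((abs_nonneg _).trans (hK i ω))
  have e : ∀ ω, (∑ i ∈ Finset.range n, c i ω) ^ 2 =
      ∑ i ∈ Finset.range n, ∑ j ∈ Finset.range n, c i ω * c j ω := fun ω => by
    rw [sq, Finset.sum_mul_sum]
  simp only [e]
  rw [integral_finsetSum _ fun i _ => integrable_finsetSum _ fun j _ => hint i j]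
  have hrow : ∀ i ∈ Finset.range n,
      ∫ ω, ∑ j ∈ Finset.range n, c i ω * c j ω ∂μ ≤ 2 * ∑' d, a d := by
    intro i _
    rw [integral_finsetSum _ fun j _ => hint i j,
      ← Finset.sum_filter_add_sum_filter_not (Finset.range n) (fun j => i ≤ j), two_mul]
    refine add_le_add ?_ ?_
    · refine le_trans (Finset.sum_le_sum fun j hj => ?_)
        (sum_le_tsum_of_injOn ha ha0 _ (e := fun j => j - i) ?_)
      · have hij : i ≤ j := (Finset.mem_filter.mp hj).2
        have := hcorr i (j - i)
        rw [Nat.add_sub_cancel' hij] at this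
        exact (le_abs_self _).trans this
      · intro j hj j' hj' h
        have h1 : i ≤ j := (Finset.mem_filter.mp hj).2
        have h2 : i ≤ j' := (Finset.mem_filter.mp hj').2
        simp only at h
        omega
    · refine le_trans (Finset.sum_le_sum fun j hj => ?_)
        (sum_le_tsum_of_injOn ha ha0 _ (e := fun j => i - j) ?_)
      · have hij : ¬ i ≤ j := (Finset.mem_filter.mp hj).2
        have := hcorr j (i - j)
        rw [Nat.add_sub_cancel' (by omega)] at this
        simp only [mul_comm (c j _)] at this
        exact (le_abs_self _).trans this
      · intro j hj j' hj' h
        have h1 : ¬ i ≤ j := (Finset.mem_filter.mp hj).2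
        have h2 : ¬ i ≤ j' := (Finset.mem_filter.mp hj').2
        simp only at h
        omega
  refine (Finset.sum_le_sum hrow).trans ?_
  rw [Finset.sum_const, Finset.card_range, nsmul_eq_mul]

/-- If the correlations of bounded random variables are summable in the time difference, then
the averages of these variables converge to zero almost surely. -/
lemma ae_tendsto_average_of_summable_correlation {μ : Measure Ω} [IsProbabilityMeasure μ]
    {c : ℕ → Ω → ℝ} (hm : ∀ n, Measurable (c n)) {K : ℝ} (hK : ∀ n ω, |c n ω| ≤ K) {a : ℕ → ℝ}
    (ha : Summable a) (ha0 : ∀ n, 0 ≤ a n)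
    (hcorr : ∀ i d, |∫ ω, c i ω * c (i + d) ω ∂μ| ≤ a d) :
    ∀ᵐ ω ∂μ, Tendsto (fun n : ℕ => (∑ i ∈ Finset.range n, c i ω) / n) atTop (𝓝 0) := by
  set T := 2 * ∑' d, a d
  let S : ℕ → Ω → ℝ := fun n ω => ∑ i ∈ Finset.range n, c i ω
  have hS : ∀ n, Measurable (S n) := fun n => Finset.measurable_fun_sum _ fun i _ => hm i
  have hSK : ∀ n ω, |S n ω| ≤ n * K := fun n ω => by
    refine (Finset.abs_sum_le_sum_abs _ _).trans ((Finset.sum_le_sum fun i _ => hK i ω).trans ?_)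
    rw [Finset.sum_const, Finset.card_range, nsmul_eq_mul]
  let f : ℕ → Ω → ℝ≥0∞ := fun k ω => ENNReal.ofReal ((S (k ^ 2) ω / (k : ℝ) ^ 2) ^ 2)
  have hf : ∀ k, Measurable (f k) := fun k =>
    (((hS _).div_const _).pow_const 2).ennreal_ofReal
  have hfint : ∀ k, ∫⁻ ω, f k ω ∂μ ≤ ENNReal.ofReal (T * (1 / (k : ℝ) ^ 2)) := by
    intro k
    rw [← ofReal_integral_eq_lintegral_ofReal]
    · refine ENNReal.ofReal_le_ofReal ?_
      simp only [div_pow]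
      rw [integral_div]
      have h := integral_sq_sum_le hm hK ha ha0 hcorr (k ^ 2)
      rcases Nat.eq_zero_or_pos k with rfl | hk
      · simp
      · have hk0 : (0 : ℝ) < k := by exact_mod_cast hk
        rw [div_le_iff₀ (by positivity)]
        refine h.trans (le_of_eq ?_)
        simp only [T]
        push_cast
        field_simp
    · refine Integrable.of_bound (C := (((k ^ 2 : ℕ) : ℝ) * K / (k : ℝ) ^ 2) ^ 2)
        (((hS _).div_const _).pow_const 2).aestronglyMeasurable (ae_of_all _ fun ω => ?_)
      rw [norm_pow, norm_div, Real.norm_eq_abs, Real.norm_of_nonneg (by positivity : (0:ℝ) ≤ k ^ 2)]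
      gcongr
      exact hSK _ ω
    · exact ae_of_all _ fun ω => sq_nonneg _
  -- The mean square of the average over `k²` terms is `O(1/k²)`. The series of squares has finite
  -- integral, hence converges almost surely, and its terms tend to zero.
  have hfin : ∫⁻ ω, ∑' k, f k ω ∂μ ≠ ∞ := by
    rw [lintegral_tsum fun k => (hf k).aemeasurable]
    refine ne_top_of_le_ne_top ?_ (ENNReal.tsum_le_tsum hfint)
    have hsum : Summable fun k : ℕ => T * (1 / (k : ℝ) ^ 2) :=
      (Real.summable_one_div_nat_pow.mpr one_lt_two).mul_left T
    exact hsum.tsum_ofReal_ne_top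
  filter_upwards [ae_lt_top (Measurable.tsum hf) hfin] with ω hω
  refine tendsto_div_of_tendsto_sq (K := K) (s := fun n => S n ω) (fun n => ?_) ?_
  · have : S (n + 1) ω - S n ω = c n ω := by
      simp only [S, Finset.sum_range_succ]; ring
    rw [this]; exact hK n ω
  · have h0 := ENNReal.tendsto_atTop_zero_of_tsum_ne_top hω.ne
    have h1 := (ENNReal.tendsto_toReal ENNReal.zero_ne_top).comp h0
    have h2 : Tendsto (fun k : ℕ => (S (k ^ 2) ω / (k : ℝ) ^ 2) ^ 2) atTop (𝓝 0) := by
      refine h1.congr fun k => ?_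
      simp only [Function.comp, f]
      exact ENNReal.toReal_ofReal (sq_nonneg _)
    have h3 := h2.sqrt
    simp only [Real.sqrt_sq_eq_abs, Real.sqrt_zero] at h3
    exact (tendsto_zero_iff_abs_tendsto_zero _).mpr h3

end Correlation

/-- After the first `d` terms are dropped, each exponent occurs exactly `l` times, so the series is
`l` copies of a geometric one. -/
lemma summable_pow_div {θ : ℝ} (h0 : 0 ≤ θ) (h1 : θ < 1) {l : ℕ} (hl : 0 < l) (d : ℕ) :
    Summable fun n : ℕ => θ ^ ((n - d) / l) := by
  rw [← summable_nat_add_iff d]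
  simp only [Nat.add_sub_cancel]
  have hblock : ∀ n, ∑ i ∈ Finset.range (n * l), θ ^ (i / l) =
      l * ∑ i ∈ Finset.range n, θ ^ i := by
    intro n
    induction n with
    | zero => simp
    | succ n ih =>
      rw [Nat.succ_mul, Finset.sum_range_add, ih, Finset.sum_range_succ, mul_add]
      congr 1
      have : ∀ i ∈ Finset.range l, θ ^ ((n * l + i) / l) = θ ^ n := fun i hi => by
        rw [mul_comm, Nat.mul_add_div hl, Nat.div_eq_of_lt (Finset.mem_range.mp hi), add_zero]
      rw [Finset.sum_congr rfl this, Finset.sum_const, Finset.card_range, nsmul_eq_mul]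
  refine summable_of_sum_range_le (c := l * ∑' i, θ ^ i) (fun n => pow_nonneg h0 _) fun n => ?_
  calc ∑ i ∈ Finset.range n, θ ^ (i / l) ≤ ∑ i ∈ Finset.range (n * l), θ ^ (i / l) :=
        Finset.sum_le_sum_of_subset_of_nonneg
          (Finset.range_mono (Nat.le_mul_of_pos_right n hl)) fun i _ _ => pow_nonneg h0 _
    _ = l * ∑ i ∈ Finset.range n, θ ^ i := hblock n
    _ ≤ l * ∑' i, θ ^ i := by
        gcongr
        exact (summable_geometric_of_lt_one h0 h1).sum_le_tsum _ fun i _ => pow_nonneg h0 _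

/-! ### Words -/

/-- The word `w 0, …, w (l - 1)` occurs in `x` at the position `b`. -/
def wordAt (w : ℕ → Fin 2) (l b : ℕ) : Set Shift2 :=
  {x | ∀ s < l, x ((b + s : ℕ) : ℤ) = w s}

/-- The integers of `[b, b + l)`. -/
def block (l b : ℕ) : Finset ℤ := (Finset.range l).image fun s => ((b + s : ℕ) : ℤ)

lemma mem_block {l b : ℕ} {i : ℤ} : i ∈ block l b ↔ (b : ℤ) ≤ i ∧ i < b + l := by
  simp only [block, Finset.mem_image, Finset.mem_range]
  constructor
  · rintro ⟨s, hs, rfl⟩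
    push_cast
    omega
  · rintro ⟨h1, h2⟩
    exact ⟨(i - b).toNat, by omega, by omega⟩

lemma dependsOn_wordAt (w : ℕ → Fin 2) (l b : ℕ) :
    DependsOn (· ∈ wordAt w l b) (block l b : Set ℤ) := by
  intro x y h
  simp only [wordAt, mem_ofPred_eq, eq_iff_iff]
  refine forall₂_congr fun s hs => ?_
  rw [h _ (mem_block.mpr ⟨by push_cast; omega, by push_cast; omega⟩)]

lemma le_bernoulliMeasure_wordAt {p : ℝ} (hp0 : 0 ≤ p) (hp1 : p ≤ 1) (w : ℕ → Fin 2) (l b : ℕ) :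
    ENNReal.ofReal (min p (1 - p) ^ l) ≤ bernoulliMeasure p (wordAt w l b) := by
  have := isProbabilityMeasure_coin hp0 hp1
  have e : wordAt w l b = Set.pi (block l b : Set ℤ) fun i => {w (i - b).toNat} := by
    ext x
    simp only [wordAt, mem_ofPred_eq, Set.mem_pi, Finset.mem_coe, mem_singleton_iff]
    constructor
    · intro h i hi
      have hi' := mem_block.mp hi
      rw [← h _ (by omega)]
      congr 1; push_cast; omega
    · intro h s hs
      rw [h _ (mem_block.mpr ⟨by push_cast; omega, by push_cast; omega⟩)]
      congr 1; push_cast; omega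
  have hc : ∀ a : Fin 2, ENNReal.ofReal (min p (1 - p)) ≤ coin p {a} := by
    intro a
    fin_cases a
    · rw [Fin.zero_eta, coin_zero]; exact ENNReal.ofReal_le_ofReal (min_le_right _ _)
    · rw [Fin.mk_one, coin_one]; exact ENNReal.ofReal_le_ofReal (min_le_left _ _)
  have hcard : (block l b).card = l := by
    rw [block, Finset.card_image_of_injective _ fun s t h => by
      have : b + s = b + t := by exact_mod_cast h
      omega, Finset.card_range]
  rw [e, bernoulliMeasure, Measure.infinitePi_pi _ fun i _ => measurableSet_singleton _,
    ENNReal.ofReal_pow (le_min hp0 (by linarith))]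
  calc ENNReal.ofReal (min p (1 - p)) ^ l
      = ∏ _i ∈ block l b, ENNReal.ofReal (min p (1 - p)) := by rw [Finset.prod_const, hcard]
    _ ≤ _ := Finset.prod_le_prod' fun i _ => hc _

/-- The `N` consecutive blocks are disjoint, hence independent, and each carries the word with
probability at least `min p (1 - p) ^ l`. -/
lemma bernoulliMeasure_real_no_word_le {p : ℝ} (hp0 : 0 ≤ p) (hp1 : p ≤ 1) (w : ℕ → Fin 2)
    {l : ℕ} (b N : ℕ) :
    (bernoulliMeasure p).real {x | ∀ m < N, x ∉ wordAt w l (b + m * l)} ≤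
      (1 - min p (1 - p) ^ l) ^ N := by
  have := isProbabilityMeasure_bernoulliMeasure hp0 hp1
  induction N with
  | zero => simp
  | succ N ih =>
    let S : Finset ℤ := block (N * l) b
    have e : {x : Shift2 | ∀ m < N + 1, x ∉ wordAt w l (b + m * l)} =
        {x | ∀ m < N, x ∉ wordAt w l (b + m * l)} ∩ (wordAt w l (b + N * l))ᶜ := by
      ext x
      simp only [mem_ofPred_eq, mem_inter_iff, mem_compl_iff]
      exact Nat.forall_lt_succ_right
    have hA : DependsOn (· ∈ {x : Shift2 | ∀ m < N, x ∉ wordAt w l (b + m * l)})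
        (S : Set ℤ) := by
      intro x y h
      simp only [mem_ofPred_eq, eq_iff_iff]
      refine forall₂_congr fun m hm => not_congr (iff_of_eq ?_)
      refine dependsOn_wordAt w l (b + m * l) fun i hi => h i ?_
      have hi' := mem_block.mp (Finset.mem_coe.mp hi)
      refine Finset.mem_coe.mpr (mem_block.mpr ?_)
      have : m * l + l ≤ N * l := by
        rw [← Nat.succ_mul]; exact Nat.mul_le_mul_right l hm
      push_cast at hi' ⊢
      have : (m : ℤ) * l + l ≤ N * l := by exact_mod_cast this
      have : (0 : ℤ) ≤ m * l := by positivity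
      constructor <;> linarith
    have hB : DependsOn (· ∈ (wordAt w l (b + N * l))ᶜ) (block l (b + N * l) : Set ℤ) := by
      intro x y h
      have := dependsOn_wordAt w l (b + N * l) h
      simp only [mem_compl_iff]
      rw [show (x ∈ wordAt w l (b + N * l)) = (y ∈ wordAt w l (b + N * l)) from this]
    have hd : Disjoint S (block l (b + N * l)) := by
      rw [Finset.disjoint_left]
      intro i hi hi'
      have h1 := mem_block.mp hi
      have h2 := mem_block.mp hi'
      push_cast at h1 h2
      linarith
    have hmeas : MeasurableSet (wordAt w l (b + N * l)) :=
      measurableSet_of_dependsOn (Finset.finite_toSet _) (dependsOn_wordAt w l _)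
    have hq : min p (1 - p) ^ l ≤ (bernoulliMeasure p).real (wordAt w l (b + N * l)) :=
      (ENNReal.ofReal_le_iff_le_toReal (measure_ne_top _ _)).mp
        (le_bernoulliMeasure_wordAt hp0 hp1 w l _)
    rw [e, measureReal_def, bernoulliMeasure_inter hp0 hp1 hA hB hd, ENNReal.toReal_mul, pow_succ,
      ← measureReal_def, ← measureReal_def, probReal_compl_eq_one_sub hmeas]
    refine mul_le_mul ih (by linarith) ?_ ?_
    · rw [sub_nonneg]; exact measureReal_le_one
    · refine pow_nonneg (sub_nonneg.mpr (pow_le_one₀ (le_min hp0 (by linarith)) ?_)) _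
      exact (min_le_left _ _).trans hp1

/-! ### Exchanging two coordinates -/

/-- Exchange of the coordinates `i` and `j`. -/
def swapCoord (i j : ℤ) (x : Shift2) : Shift2 := fun l => x (Equiv.swap i j l)

lemma swapCoord_of_ne {i j l : ℤ} (hi : l ≠ i) (hj : l ≠ j) (x : Shift2) :
    swapCoord i j x l = x l := by
  rw [swapCoord, Equiv.swap_apply_of_ne_of_ne hi hj]

lemma swapCoord_left (i j : ℤ) (x : Shift2) : swapCoord i j x i = x j := by
  rw [swapCoord, Equiv.swap_apply_left]

lemma swapCoord_right (i j : ℤ) (x : Shift2) : swapCoord i j x j = x i := by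
  rw [swapCoord, Equiv.swap_apply_right]

lemma measurable_swapCoord (i j : ℤ) : Measurable (swapCoord i j) :=
  measurable_pi_iff.mpr fun _ => measurable_pi_apply _

/-- Exchanging two coordinates preserves the measure for every `p`; altering a single symbol would
do so only for `p = 1/2`. This is why the cancellation is built on exchanges. -/
lemma map_swapCoord {p : ℝ} (hp0 : 0 ≤ p) (hp1 : p ≤ 1) (i j : ℤ) :
    (bernoulliMeasure p).map (swapCoord i j) = bernoulliMeasure p := by
  have := isProbabilityMeasure_coin hp0 hp1
  exact Measure.map_infinitePi_infinitePi_of_inj (P := fun _ : ℤ => coin p)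
    (Equiv.swap i j).injective

lemma integral_eq_zero_of_swapCoord {p : ℝ} (hp0 : 0 ≤ p) (hp1 : p ≤ 1) {i j : ℤ}
    {F : Shift2 → ℝ} (hF : Measurable F) (h : ∀ x, F (swapCoord i j x) = -F x) :
    ∫ x, F x ∂(bernoulliMeasure p) = 0 := by
  have h1 : ∫ x, F x ∂(bernoulliMeasure p) = ∫ x, F (swapCoord i j x) ∂(bernoulliMeasure p) := by
    rw [← integral_map (measurable_swapCoord i j).aemeasurable hF.aestronglyMeasurable,
      map_swapCoord hp0 hp1]
  simp only [h, integral_neg] at h1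
  linarith

/-- A word of length `l` with two distinguished places `a`, `a'`, holding different symbols. -/
structure FlipWord where
  l : ℕ
  a : ℕ
  a' : ℕ
  w : ℕ → Fin 2
  a_lt : a < l
  a'_lt : a' < l
  ne : w a ≠ w a'

/-- The word, or the word with its two distinguished symbols exchanged, occurs at `b`. -/
def FlipWord.occurs (v : FlipWord) (b : ℕ) : Set Shift2 :=
  {x | (∀ s < v.l, s ≠ v.a → s ≠ v.a' → x ((b + s : ℕ) : ℤ) = v.w s) ∧
    x ((b + v.a : ℕ) : ℤ) ≠ x ((b + v.a' : ℕ) : ℤ)}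

/-- Exchange of the two distinguished symbols of the word at `b`. -/
def FlipWord.flip (v : FlipWord) (b : ℕ) : Shift2 → Shift2 :=
  swapCoord ((b + v.a : ℕ) : ℤ) ((b + v.a' : ℕ) : ℤ)

/-- The exchange of the two symbols of the word changes the sign of `g` along the orbit an odd
number of times, at times of the block where the word occurs. -/
def FlipWord.Flips (v : FlipWord) (g : Shift2 → ℝ) : Prop :=
  ∃ D : Finset ℕ, D ⊆ Finset.range v.l ∧ Odd D.card ∧ ∀ b, ∀ x ∈ v.occurs b, ∀ i : ℕ,
    g ((shift ^ i) (v.flip b x)) =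
      (if i ∈ D.image (b + ·) then -1 else 1) * g ((shift ^ i) x)

lemma FlipWord.flip_apply_of_notMem (v : FlipWord) {b : ℕ} {i : ℤ} (hi : i ∉ block v.l b)
    (x : Shift2) : v.flip b x i = x i := by
  have h1 := v.a_lt
  have h2 := v.a'_lt
  rw [mem_block] at hi
  refine swapCoord_of_ne ?_ ?_ x <;> (push_cast; omega)

lemma FlipWord.dependsOn_occurs (v : FlipWord) (b : ℕ) :
    DependsOn (· ∈ v.occurs b) (block v.l b : Set ℤ) := by
  intro x y h
  have hs : ∀ s < v.l, x ((b + s : ℕ) : ℤ) = y ((b + s : ℕ) : ℤ) := fun s hs =>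
    h _ (mem_block.mpr ⟨by push_cast; omega, by push_cast; omega⟩)
  simp only [FlipWord.occurs, mem_ofPred_eq, eq_iff_iff]
  refine and_congr (forall₂_congr fun s hsl => ?_) ?_
  · rw [hs s hsl]
  · rw [hs _ v.a_lt, hs _ v.a'_lt]

lemma FlipWord.flip_mem_occurs_self (v : FlipWord) {b : ℕ} {x : Shift2} :
    v.flip b x ∈ v.occurs b ↔ x ∈ v.occurs b := by
  simp only [FlipWord.occurs, mem_ofPred_eq]
  refine and_congr (forall₂_congr fun s _ => forall₂_congr fun h1 h2 => ?_) ?_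
  · rw [FlipWord.flip, swapCoord_of_ne (by simpa using h1) (by simpa using h2)]
  · rw [FlipWord.flip, swapCoord_left, swapCoord_right]
    exact ne_comm

lemma FlipWord.wordAt_subset_occurs (v : FlipWord) (b : ℕ) : wordAt v.w v.l b ⊆ v.occurs b := by
  intro x hx
  refine ⟨fun s hs _ _ => hx s hs, ?_⟩
  rw [hx _ v.a_lt, hx _ v.a'_lt]
  exact v.ne

/-- If `F` changes sign under the exchange in each of the blocks `[b + m l, b + (m+1) l)`,
`m < N`, where the word occurs, its mean is at most the probability that it occurs in none. -/
lemma FlipWord.abs_integral_le {p : ℝ} (hp0 : 0 ≤ p) (hp1 : p ≤ 1) (v : FlipWord)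
    {F : Shift2 → ℝ} (hF : Measurable F) {K : ℝ} (hK : ∀ x, |F x| ≤ K) (b N : ℕ)
    (h : ∀ m < N, ∀ x ∈ v.occurs (b + m * v.l), F (v.flip (b + m * v.l) x) = -F x) :
    |∫ x, F x ∂(bernoulliMeasure p)| ≤ K * (1 - min p (1 - p) ^ v.l) ^ N := by
  have := isProbabilityMeasure_bernoulliMeasure hp0 hp1
  have hK0 : 0 ≤ K := (abs_nonneg _).trans (hK 0)
  let A : ℕ → Set Shift2 := fun n => {x | ∀ m < n, x ∉ v.occurs (b + m * v.l)}
  have hocc : ∀ m, MeasurableSet (v.occurs (b + m * v.l)) := fun m =>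
    measurableSet_of_dependsOn (Finset.finite_toSet _) (v.dependsOn_occurs _)
  have hA : ∀ n, MeasurableSet (A n) := fun n => by
    have : A n = ⋂ m, ⋂ (_ : m < n), (v.occurs (b + m * v.l))ᶜ := by
      ext x; simp [A]
    rw [this]
    exact MeasurableSet.iInter fun m => MeasurableSet.iInter fun _ => (hocc m).compl
  have hint : Integrable F (bernoulliMeasure p) :=
    Integrable.of_bound hF.aestronglyMeasurable K (ae_of_all _ hK)
  -- Blocks are removed one at a time: the part of the integral over the points where the word
  -- occurs in block `n`, but in no earlier one, vanishes by antisymmetry.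
  have hstep : ∀ n ≤ N, ∫ x, F x ∂(bernoulliMeasure p) =
      ∫ x in A n, F x ∂(bernoulliMeasure p) := by
    intro n
    induction n with
    | zero =>
      intro _
      have : A 0 = univ := by ext x; simp [A]
      rw [this, setIntegral_univ]
    | succ n ih =>
      intro hn
      rw [ih (by omega), ← integral_inter_add_sdiff (hocc n) hint.integrableOn]
      have e : A n \ v.occurs (b + n * v.l) = A (n + 1) := by
        ext x
        simp only [A, Set.mem_sdiff, mem_ofPred_eq]
        exact Nat.forall_lt_succ_right.symm
      have hzero : ∫ x in A n ∩ v.occurs (b + n * v.l), F x ∂(bernoulliMeasure p) = 0 := by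
        rw [← integral_indicator ((hA n).inter (hocc n))]
        refine integral_eq_zero_of_swapCoord hp0 hp1 (i := ((b + n * v.l + v.a : ℕ) : ℤ))
          (j := ((b + n * v.l + v.a' : ℕ) : ℤ)) (hF.indicator ((hA n).inter (hocc n)))
          fun x => ?_
        change indicator _ F (v.flip (b + n * v.l) x) = _
        -- The exchange acts inside block `n` only, so it respects the absence of the word from
        -- earlier blocks, and `occurs` admits both orders of the two symbols.
        have hmem : v.flip (b + n * v.l) x ∈ A n ∩ v.occurs (b + n * v.l) ↔
            x ∈ A n ∩ v.occurs (b + n * v.l) := by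
          refine and_congr ?_ v.flip_mem_occurs_self
          refine forall₂_congr fun m hm => not_congr (iff_of_eq ?_)
          refine v.dependsOn_occurs (b + m * v.l) fun i hi => v.flip_apply_of_notMem ?_ x
          have hi' := mem_block.mp (Finset.mem_coe.mp hi)
          rw [mem_block]
          have : m * v.l + v.l ≤ n * v.l := by
            rw [← Nat.succ_mul]; exact Nat.mul_le_mul_right _ hm
          have : (m : ℤ) * v.l + v.l ≤ n * v.l := by exact_mod_cast this
          push_cast at hi' ⊢
          intro hcon
          linarith [hcon.1, hi'.2]
        by_cases hx : x ∈ A n ∩ v.occurs (b + n * v.l)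
        · rw [indicator_of_mem hx, indicator_of_mem (hmem.mpr hx), h n (by omega) x hx.2]
        · rw [indicator_of_notMem hx, indicator_of_notMem (mt hmem.mp hx), neg_zero]
      rw [e, hzero, zero_add]
  rw [hstep N le_rfl]
  have hsub : A N ⊆ {x | ∀ m < N, x ∉ wordAt v.w v.l (b + m * v.l)} := fun x hx m hm hw =>
    hx m hm (v.wordAt_subset_occurs _ hw)
  calc |∫ x in A N, F x ∂(bernoulliMeasure p)|
      ≤ K * (bernoulliMeasure p).real (A N) := by
        rw [← Real.norm_eq_abs]
        exact norm_setIntegral_le_of_norm_le_const (measure_lt_top _ _) fun x _ => hK x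
    _ ≤ K * (1 - min p (1 - p) ^ v.l) ^ N := by
        refine mul_le_mul_of_nonneg_left ?_ hK0
        exact (measureReal_mono hsub).trans (bernoulliMeasure_real_no_word_le hp0 hp1 v.w b N)

/-! ### Signed ergodic sums -/

/-- The sign of the iterate, for a cocycle with values in `{1, -1}`. -/
noncomputable def signProd (g : Shift2 → ℝ) (n : ℕ) (x : Shift2) : ℝ :=
  ∏ i ∈ Finset.range n, g ((shift ^ i) x)

lemma measurable_comp_shift_pow {F : Shift2 → ℝ} {R : ℕ} (hF : DependsOn F (window R)) (n : ℕ) :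
    Measurable fun x => F ((shift ^ n) x) :=
  measurable_of_dependsOn (finite_Icc _ _) (dependsOn_shift_pow hF n)

/-- Ergodic sums twisted by a sign that an exchange of symbols can change are `o(n)`. -/
theorem ae_tendsto_signed_average {p : ℝ} (hp0 : 0 < p) (hp1 : p < 1) {g φ : Shift2 → ℝ} {R : ℕ}
    (hg : ∀ x, g x = 1 ∨ g x = -1) (hgR : DependsOn g (window R)) {K : ℝ} (hφ : ∀ x, |φ x| ≤ K)
    (hφR : DependsOn φ (window R)) {v : FlipWord} (hv : v.Flips g) :
    ∀ᵐ x ∂(bernoulliMeasure p), Tendsto (fun n : ℕ =>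
      (∑ j ∈ Finset.range n, signProd g (j + 1) x * φ ((shift ^ j) x)) / n) atTop (𝓝 0) := by
  classical
  have := isProbabilityMeasure_bernoulliMeasure hp0.le hp1.le
  have hK0 : 0 ≤ K := (abs_nonneg _).trans (hφ 0)
  have hg1 : ∀ x, |g x| = 1 := fun x => by rcases hg x with h | h <;> simp [h]
  have hgg : ∀ x, g x * g x = 1 := fun x => by rcases hg x with h | h <;> simp [h]
  have hprod : ∀ (s : Finset ℕ) x, |∏ i ∈ s, g ((shift ^ i) x)| = 1 := fun s x => by
    rw [Finset.abs_prod]; exact Finset.prod_eq_one fun i _ => hg1 _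
  set q := min p (1 - p) ^ v.l with hq
  have hmin : 0 < min p (1 - p) := lt_min hp0 (by linarith)
  have hq0 : 0 < q := pow_pos hmin _
  have hq1 : q ≤ 1 := pow_le_one₀ hmin.le ((min_le_left _ _).trans hp1.le)
  have hl : 0 < v.l := lt_of_le_of_lt (Nat.zero_le _) v.a_lt
  -- Between times `j` and `j + d` the coordinates not seen by the two factors `φ` leave room for
  -- `(d - (2R + 1)) / l` disjoint blocks.
  refine ae_tendsto_average_of_summable_correlation (K := K)
    (c := fun j x => signProd g (j + 1) x * φ ((shift ^ j) x))
    (a := fun d => K * K * (1 - q) ^ ((d - (2 * R + 1)) / v.l)) (fun n => ?_) (fun n x => ?_)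
    ((summable_pow_div (by linarith) (by linarith) hl _).mul_left _) (fun n => ?_) ?_
  · exact (Finset.measurable_fun_prod _ fun i _ => measurable_comp_shift_pow hgR i).mul
      (measurable_comp_shift_pow hφR n)
  · rw [abs_mul, signProd, hprod, one_mul]; exact hφ _
  · exact mul_nonneg (mul_nonneg hK0 hK0) (pow_nonneg (by linarith) _)
  intro j d
  -- The signs up to time `j` occur twice and cancel; only those of the times `j + 1, …, j + d`
  -- survive.
  let F : Shift2 → ℝ := fun x =>
    φ ((shift ^ j) x) * φ ((shift ^ (j + d)) x) *
      ∏ i ∈ Finset.Ico (j + 1) (j + d + 1), g ((shift ^ i) x)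
  have hFe : ∀ x, signProd g (j + 1) x * φ ((shift ^ j) x) *
      (signProd g (j + d + 1) x * φ ((shift ^ (j + d)) x)) = F x := by
    intro x
    have h1 : signProd g (j + d + 1) x =
        signProd g (j + 1) x * ∏ i ∈ Finset.Ico (j + 1) (j + d + 1), g ((shift ^ i) x) :=
      (Finset.prod_range_mul_prod_Ico _ (by omega)).symm
    have h2 : signProd g (j + 1) x * signProd g (j + 1) x = 1 := by
      rw [signProd, ← Finset.prod_mul_distrib]; exact Finset.prod_eq_one fun i _ => hgg _
    rw [h1]
    simp only [F]
    linear_combination (φ ((shift ^ j) x) * φ ((shift ^ (j + d)) x) *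
      ∏ i ∈ Finset.Ico (j + 1) (j + d + 1), g ((shift ^ i) x)) * h2
  simp only [hFe]
  have hFm : Measurable F :=
    ((measurable_comp_shift_pow hφR _).mul (measurable_comp_shift_pow hφR _)).mul
      (Finset.measurable_fun_prod _ fun i _ => measurable_comp_shift_pow hgR i)
  have hFK : ∀ x, |F x| ≤ K * K := fun x => by
    simp only [F]
    rw [abs_mul, hprod, mul_one, abs_mul]
    exact mul_le_mul (hφ _) (hφ _) (abs_nonneg _) hK0
  -- `j + R + 1` is the first coordinate to the right of the window seen by `φ` at time `j`.
  refine v.abs_integral_le hp0.le hp1.le hFm hFK (j + R + 1) _ fun m hm x hx => ?_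
  obtain ⟨D, hD, hodd, hflip⟩ := hv
  have hroom : (m + 1) * v.l + (2 * R + 1) ≤ d := by
    have h1 : (m + 1) * v.l ≤ d - (2 * R + 1) :=
      (Nat.mul_le_mul_right _ hm).trans (Nat.div_mul_le_self _ _)
    -- Having a block at all forces `d > 2R + 1`, so the truncated subtraction is a genuine one.
    have h2 : 1 ≤ (m + 1) * v.l := Nat.mul_pos (by omega) hl
    omega
  rw [Nat.succ_mul] at hroom
  have hout : ∀ t : ℕ, t ≤ j ∨ j + d ≤ t → ∀ y, φ ((shift ^ t) (v.flip (j + R + 1 + m * v.l) y)) =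
      φ ((shift ^ t) y) := by
    intro t ht y
    refine dependsOn_shift_pow hφR t fun i hi => v.flip_apply_of_notMem ?_ y
    rw [mem_block]
    have hi1 := hi.1
    have hi2 := hi.2
    have : (m : ℤ) * v.l + v.l + (2 * R + 1) ≤ d := by exact_mod_cast hroom
    have hml : (0 : ℤ) ≤ m * v.l := by positivity
    push_cast
    intro hcon
    rcases ht with ht | ht
    · have : (t : ℤ) ≤ j := by exact_mod_cast ht
      linarith [hcon.1]
    · have : (j : ℤ) + d ≤ t := by exact_mod_cast ht
      linarith [hcon.2]
  simp only [F]
  rw [hout j (Or.inl le_rfl), hout (j + d) (Or.inr le_rfl)]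
  simp only [hflip _ x hx]
  rw [Finset.prod_mul_distrib, Finset.prod_ite, Finset.prod_const_one, mul_one, Finset.prod_const]
  -- All the times at which the sign changes lie in the range of the product, so the total factor is
  -- `(-1) ^ |D| = -1`.
  have hfil : {i ∈ Finset.Ico (j + 1) (j + d + 1) |
      i ∈ D.image (j + R + 1 + m * v.l + ·)} = D.image (j + R + 1 + m * v.l + ·) := by
    refine Finset.filter_mem_eq_inter.trans (Finset.inter_eq_right.mpr fun i hi => ?_)
    obtain ⟨s, hs, rfl⟩ := Finset.mem_image.mp hi
    have := Finset.mem_range.mp (hD hs)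
    rw [Finset.mem_Ico]
    omega
  rw [hfil, Finset.card_image_of_injective _ (add_right_injective _), hodd.neg_one_pow]
  ring

/-! ### Cocycles that act monomially over a tower -/

lemma fwd_succ' (C : Cocycle) (n : ℕ) (x : Shift2) :
    fwd C (n + 1) x = fwd C n (shift x) * C x := by
  induction n with
  | zero => simp [fwd]
  | succ n ih =>
    change C ((shift ^ (n + 1)) x) * fwd C (n + 1) x = C ((shift ^ n) (shift x)) *
      fwd C n (shift x) * C x
    rw [ih, pow_succ, Equiv.Perm.mul_apply, mul_assoc]

lemma opNorm_one : opNorm 1 = 1 := by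
  rw [opNorm, act_one]
  exact ContinuousLinearMap.norm_id

lemma exists_opNorm_fwd_le (C : Cocycle) :
    ∃ K, 1 ≤ K ∧ ∀ n x, opNorm (fwd C n x) ≤ K ^ n := by
  obtain ⟨K, hK⟩ := exists_opNorm_bound C
  refine ⟨max K 1, le_max_right _ _, fun n x => ?_⟩
  induction n with
  | zero =>
    change opNorm ((1 : SL2) : Mat2) ≤ _
    rw [Matrix.SpecialLinearGroup.coe_one, opNorm_one, pow_zero]
  | succ n ih =>
    change opNorm ((C ((shift ^ n) x) * fwd C n x : SL2) : Mat2) ≤ _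
    rw [Matrix.SpecialLinearGroup.coe_mul, pow_succ']
    refine (opNorm_mul_le _ _).trans ?_
    exact mul_le_mul ((hK _).trans (le_max_left _ _)) ih (opNorm_nonneg _) (by positivity)

open Classical in
/-- The sign that changes on visits to `W`. -/
noncomputable def visitSign (W : Set Shift2) (x : Shift2) : ℝ := if x ∈ W then -1 else 1

open Classical in
/-- The time needed to leave the tower of height `h` over `W`, counted as zero on `W` and outside
of the tower. -/
noncomputable def remaining (W : Set Shift2) (h : ℕ) (x : Shift2) : ℕ :=
  ∑ i ∈ Finset.Ico 1 h, if x ∈ (shift ^ i : Equiv.Perm Shift2) '' W then h - i else 0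

lemma dependsOn_visitSign {W : Set Shift2} {s : Set ℤ} (hW : DependsOn (· ∈ W) s) :
    DependsOn (visitSign W) s := by
  intro x y hxy
  have : (x ∈ W) = (y ∈ W) := hW hxy
  classical
  exact if_congr (iff_of_eq this) rfl rfl

lemma dependsOn_remaining {W : Set Shift2} {R : ℕ} (hW : DependsOn (· ∈ W) (window R)) (h : ℕ) :
    DependsOn (remaining W h) (window (R + h)) := by
  intro x y hxy
  refine Finset.sum_congr rfl fun i hi => ?_
  have hi' := (Finset.mem_Ico.mp hi).2
  have : (x ∈ (shift ^ i : Equiv.Perm Shift2) '' W) = (y ∈ (shift ^ i : Equiv.Perm Shift2) '' W) :=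
    dependsOn_mem_image hW i fun j hj => hxy j (window_mono (by omega) hj)
  classical
  exact if_congr (iff_of_eq this) rfl rfl

/-- The sets `W, f(W), …, f^{h-1}(W)` are disjoint. -/
def IsTowerBase (W : Set Shift2) (h : ℕ) : Prop :=
  ∀ x ∈ W, ∀ i, 0 < i → i < h → (shift ^ i) x ∉ W

section Tower

variable {W : Set Shift2} {h : ℕ}

/-- Otherwise the point of `W` below `x` at depth `i` would return to `W` after `i - j < h` steps.
-/
lemma IsTowerBase.le_of_mem (hW : IsTowerBase W h) {x : Shift2} {i j : ℕ} (hi : i < h)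
    (hxi : x ∈ (shift ^ i : Equiv.Perm Shift2) '' W)
    (hxj : x ∈ (shift ^ j : Equiv.Perm Shift2) '' W) : i ≤ j := by
  by_contra hlt
  obtain ⟨y, hy, rfl⟩ := hxi
  obtain ⟨z, hz, hzy⟩ := hxj
  refine hW y hy (i - j) (by omega) (by omega) ?_
  have e : (shift ^ i) y = (shift ^ j) ((shift ^ (i - j)) y) := by
    rw [← Equiv.Perm.mul_apply, ← pow_add]
    congr 2
    omega
  rw [e] at hzy
  rwa [← (shift ^ j).injective hzy]

lemma IsTowerBase.index_unique (hW : IsTowerBase W h) {x : Shift2} {i j : ℕ} (hi : i < h)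
    (hj : j < h) (hxi : x ∈ (shift ^ i : Equiv.Perm Shift2) '' W)
    (hxj : x ∈ (shift ^ j : Equiv.Perm Shift2) '' W) : i = j :=
  le_antisymm (hW.le_of_mem hi hxi hxj) (hW.le_of_mem hj hxj hxi)

lemma IsTowerBase.remaining_of_mem (hW : IsTowerBase W h) {x : Shift2} {i : ℕ} (hi0 : 0 < i)
    (hi : i < h) (hx : x ∈ (shift ^ i : Equiv.Perm Shift2) '' W) : remaining W h x = h - i := by
  rw [remaining, Finset.sum_eq_single i]
  · exact if_pos hx
  · intro j hj hji
    refine if_neg fun hxj => hji ?_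
    exact hW.index_unique (Finset.mem_Ico.mp hj).2 hi hxj hx
  · intro hn
    exact absurd (Finset.mem_Ico.mpr ⟨hi0, hi⟩) hn

lemma remaining_eq_zero {x : Shift2}
    (hx : ∀ i, 0 < i → i < h → x ∉ (shift ^ i : Equiv.Perm Shift2) '' W) :
    remaining W h x = 0 :=
  Finset.sum_eq_zero fun i hi => if_neg (hx i (Finset.mem_Ico.mp hi).1 (Finset.mem_Ico.mp hi).2)

lemma IsTowerBase.remaining_le (hW : IsTowerBase W h) (x : Shift2) : remaining W h x ≤ h := by
  by_cases hx : ∀ i, 0 < i → i < h → x ∉ (shift ^ i : Equiv.Perm Shift2) '' W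
  · rw [remaining_eq_zero hx]; exact Nat.zero_le _
  · push Not at hx
    obtain ⟨i, hi0, hi, hxi⟩ := hx
    rw [hW.remaining_of_mem hi0 hi hxi]; exact Nat.sub_le _ _

lemma shift_mem_image_succ {x : Shift2} {i : ℕ} :
    shift x ∈ (shift ^ (i + 1) : Equiv.Perm Shift2) '' W ↔
      x ∈ (shift ^ i : Equiv.Perm Shift2) '' W := by
  rw [pow_succ', Equiv.Perm.coe_mul, image_comp, shift.injective.mem_set_image]

lemma IsTowerBase.remaining_shift (hW : IsTowerBase W h) {x : Shift2} {i : ℕ}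
    (hi : i < h) (hx : x ∈ (shift ^ i : Equiv.Perm Shift2) '' W) :
    remaining W h (shift x) = h - i - 1 := by
  rcases (by omega : i + 1 < h ∨ i + 1 = h) with h1 | h1
  · rw [hW.remaining_of_mem (Nat.succ_pos i) h1 (shift_mem_image_succ.mpr hx)]; omega
  · rw [remaining_eq_zero fun j hj0 hj hxj => ?_]
    · omega
    · obtain ⟨j, rfl⟩ := Nat.exists_eq_succ_of_ne_zero hj0.ne'
      have := hW.index_unique hi (by omega) hx (shift_mem_image_succ.mp hxj)
      omega

end Tower

/-- If a cocycle coincides with the diagonal one off a tower, and if the passage through the tower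
is a fixed antidiagonal matrix, then its exponents vanish, provided that an exchange of two symbols
can change the parity of the number of visits to the tower. -/
theorem zeroExponents_of_tower {p σ : ℝ} (hp0 : 0 < p) (hp1 : p < 1) (hσ : 1 < σ) {C : Cocycle}
    {W : Set Shift2} {h R : ℕ} (hh : 0 < h) (hWR : DependsOn (· ∈ W) (window R))
    (hW : IsTowerBase W h) (hoff : ∀ x, x ∉ tower W 0 h → C x = cocA σ hσ x) {q : SL2}
    (hq00 : (q : Mat2) 0 0 = 0) (hq11 : (q : Mat2) 1 1 = 0) (hq : ∀ x ∈ W, fwd C h x = q)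
    {v : FlipWord} (hv : v.Flips (visitSign W)) : ZeroExponents p C := by
  classical
  obtain ⟨t, ht⟩ := exists_isMonomial_of_antidiagonal hq00 hq11
  set g := visitSign W with hg
  let φ : Shift2 → ℝ := fun x =>
    if x ∈ W then t else if remaining W h x = 0 then (if x 0 = 1 then Real.log σ else 0) else 0
  -- `H` completes the passage in progress. With this correction the whole matrix `q` is charged to
  -- the entry into the tower and the other levels contribute nothing.
  let H : Shift2 → SL2 := fun x => fwd C (remaining W h x) x
  have hgg : ∀ x, g x * g x = 1 := fun x => by
    rw [hg, visitSign]; split_ifs <;> norm_num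
  have hH0 : ∀ x, remaining W h x = 0 → H x = 1 := fun x hx => by
    simp only [H, hx, fwd]
  -- Three cases: on the base the corrected step is `q`; on the other levels a factor merely passes
  -- from `H` to the iterate; off the tower the step is diagonal and `H` is trivial at both ends.
  have hstep : ∀ x s m, IsMonomial s (H x * m) →
      IsMonomial (g x * s + φ x) (H (shift x) * (C x * m)) := by
    intro x s m hm
    by_cases hin : ∃ i < h, x ∈ (shift ^ i : Equiv.Perm Shift2) '' W
    · obtain ⟨i, hi, hxi⟩ := hin
      have hr := hW.remaining_shift hi hxi
      rcases Nat.eq_zero_or_pos i with rfl | hi0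
      · have hx : x ∈ W := by simpa using hxi
        have hrx : remaining W h x = 0 := remaining_eq_zero fun j hj0 hj hxj => by
          have := hW.index_unique hi hj hxi hxj
          omega
        have hgx : g x = -1 := if_pos hx
        have hφx : φ x = t := if_pos hx
        have e : H (shift x) * (C x * m) = q * m := by
          rw [← mul_assoc, ← hq x hx]
          simp only [H, hr]
          obtain ⟨h', rfl⟩ := Nat.exists_eq_succ_of_ne_zero hh.ne'
          rw [Nat.succ_eq_add_one, fwd_succ']
          rfl
        rw [hH0 x hrx, one_mul] at hm
        rw [hgx, hφx, e, neg_one_mul]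
        exact ht s m hm
      · have hx : x ∉ W := fun hx => by
          have := hW.index_unique hi hh hxi (j := 0) (by simpa using hx)
          omega
        have hrx := hW.remaining_of_mem hi0 hi hxi
        have hgx : g x = 1 := if_neg hx
        have hφx : φ x = 0 := by
          simp only [φ, if_neg hx]
          rw [if_neg (by omega)]
        have e : H (shift x) * (C x * m) = H x * m := by
          rw [← mul_assoc]
          simp only [H, hr, hrx]
          obtain ⟨d, hd⟩ := Nat.exists_eq_succ_of_ne_zero (by omega : h - i ≠ 0)
          rw [hd, Nat.succ_eq_add_one, fwd_succ']
          rfl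
        rw [hgx, hφx, e, one_mul, add_zero]
        exact hm
    · push Not at hin
      have hx : x ∉ W := fun hx => hin 0 hh (by simpa using hx)
      have hrx : remaining W h x = 0 := remaining_eq_zero fun i _ hi => hin i hi
      have hrx' : remaining W h (shift x) = 0 := remaining_eq_zero fun j hj0 hj hxj => by
        obtain ⟨j, rfl⟩ := Nat.exists_eq_succ_of_ne_zero hj0.ne'
        exact hin j (by omega) (shift_mem_image_succ.mp hxj)
      have hC : C x = cocA σ hσ x := hoff x fun hxt => by
        simp only [tower, mem_iUnion, Finset.mem_Ico] at hxt
        obtain ⟨i, ⟨-, hi⟩, hxi⟩ := hxt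
        exact hin i hi hxi
      have hgx : g x = 1 := if_neg hx
      have hφx : φ x = if x 0 = 1 then Real.log σ else 0 := by
        simp only [φ, if_neg hx, hrx, if_true]
      rw [hH0 x hrx, one_mul] at hm
      rw [hH0 _ hrx', one_mul, hgx, one_mul, hφx, hC, cocA_apply]
      split_ifs
      · exact hm.diagSL_mul _
      · rwa [one_mul, add_zero]
  let U : ℕ → Shift2 → ℝ := fun n x =>
    ∑ j ∈ Finset.range n, signProd g (j + 1) x * φ ((shift ^ j) x)
  have hs2 : ∀ n x, signProd g n x * signProd g n x = 1 := fun n x => by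
    rw [signProd, ← Finset.prod_mul_distrib]; exact Finset.prod_eq_one fun i _ => hgg _
  -- The recurrence `s ↦ g s + φ` is solved by factoring out the accumulated sign, which squares to
  -- one.
  have hmono : ∀ n x, IsMonomial (signProd g n x * U n x)
      (H ((shift ^ n) x) * (fwd C n x * (H x)⁻¹)) := by
    intro n x
    induction n with
    | zero =>
      have e : H ((shift ^ 0) x) * (fwd C 0 x * (H x)⁻¹) = 1 := by
        simp [fwd]
      rw [e]
      simpa [U] using isMonomial_one
    | succ n ih =>
      have h1 := hstep _ _ _ ih
      have e1 : signProd g (n + 1) x = signProd g n x * g ((shift ^ n) x) :=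
        Finset.prod_range_succ _ _
      have e2 : g ((shift ^ n) x) * (signProd g n x * U n x) + φ ((shift ^ n) x) =
          signProd g (n + 1) x * U (n + 1) x := by
        have e3 : U (n + 1) x = U n x + signProd g (n + 1) x * φ ((shift ^ n) x) :=
          Finset.sum_range_succ _ _
        have e4 := hs2 (n + 1) x
        rw [e3, mul_add, ← mul_assoc (signProd g (n + 1) x) (signProd g (n + 1) x), e4, e1]
        ring
      rw [e2, ← mul_assoc (C _)] at h1
      rw [pow_succ', Equiv.Perm.mul_apply]
      exact h1
  obtain ⟨K, hK1, hK⟩ := exists_opNorm_fwd_le C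
  have hHK : ∀ x, opNorm (H x) ≤ K ^ h := fun x =>
    (hK _ x).trans (pow_le_pow_right₀ hK1 (hW.remaining_le x))
  have hKpos : 0 < K ^ h := by positivity
  have habs : ∀ n x, |signProd g n x * U n x| = |U n x| := fun n x => by
    rw [abs_mul]
    have := hs2 n x
    rw [← abs_mul_abs_self] at this
    have h1 : |signProd g n x| = 1 := by nlinarith [abs_nonneg (signProd g n x)]
    rw [h1, one_mul]
  -- Undoing the correction at both ends costs a constant independent of `n`: at most `h` steps
  -- remain, and the two factors 4 come from the inverse and from the monomial matrix.
  have hupper : ∀ n x, opNorm (fwd C n x) ≤ 16 * (K ^ h * K ^ h) * Real.exp |U n x| := by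
    intro n x
    have e : fwd C n x = (H ((shift ^ n) x))⁻¹ *
        ((H ((shift ^ n) x) * (fwd C n x * (H x)⁻¹)) * H x) := by group
    have h1 := (hmono n x).opNorm_le
    rw [habs] at h1
    rw [e, Matrix.SpecialLinearGroup.coe_mul, Matrix.SpecialLinearGroup.coe_mul]
    refine (opNorm_mul_le _ _).trans ?_
    calc opNorm ((H ((shift ^ n) x))⁻¹ : SL2) *
          opNorm (((H ((shift ^ n) x) * (fwd C n x * (H x)⁻¹) : SL2) : Mat2) * (H x : Mat2))
        ≤ (4 * K ^ h) * ((4 * Real.exp |U n x|) * K ^ h) := by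
          refine mul_le_mul ?_ ?_ (opNorm_nonneg _) (by positivity)
          · refine (opNorm_inv_le _).trans ?_
            linarith [hHK ((shift ^ n) x)]
          · refine (opNorm_mul_le _ _).trans ?_
            exact mul_le_mul h1 (hHK x) (opNorm_nonneg _) (by positivity)
      _ = _ := by ring
  have hlim := ae_tendsto_signed_average hp0 hp1 (g := g) (φ := φ) (R := R + h)
    (fun x => by rw [hg, visitSign]; split_ifs <;> simp)
    (dependsOn_visitSign fun x y hxy => hWR fun i hi => hxy i (window_mono (by omega) hi))
    (K := |t| + Real.log σ) (fun x => by
      have hlog := Real.log_nonneg hσ.le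
      simp only [φ]
      split_ifs
      · linarith
      · rw [abs_of_nonneg hlog]; linarith [abs_nonneg t]
      · rw [abs_zero]; positivity
      · rw [abs_zero]; positivity)
    (fun x y hxy => by
      have h1 : (x ∈ W) = (y ∈ W) := hWR fun i hi => hxy i (window_mono (by omega) hi)
      have h2 := dependsOn_remaining hWR h hxy
      have h3 : x 0 = y 0 := hxy 0 (by simp [window])
      simp only [φ, h1, h2, h3]) hv
  have hup : IsUpperExponent p C 0 := by
    -- The comparison sequence is the logarithm itself, with error 0; it lies between `-log 2` and
    -- `|U n x|` plus a constant.
    refine isUpperExponent_of_bound 0 (fun n x => Real.log (opNorm (fwd C n x))) ?_ (by simp)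
    filter_upwards [hlim] with x hx
    set c := |Real.log (16 * (K ^ h * K ^ h))| + Real.log 2
    have hc : Tendsto (fun n : ℕ => c / n + |U n x / n|) atTop (𝓝 0) := by
      have := (tendsto_const_div_atTop_nhds_zero_nat c).add hx.abs
      simpa using this
    refine squeeze_zero_norm (fun n => ?_) hc
    rw [norm_div, Real.norm_eq_abs, Real.norm_natCast, abs_div, Nat.abs_cast, ← add_div]
    refine div_le_div_of_nonneg_right ?_ (Nat.cast_nonneg n)
    have h1 := Real.log_le_log (opNorm_pos _) (hupper n x)
    rw [Real.log_mul (by positivity) (Real.exp_pos _).ne', Real.log_exp] at h1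
    have h2 := Real.log_le_log (by norm_num) (half_le_opNorm (fwd C n x))
    rw [one_div, Real.log_inv] at h2
    have h3 : 0 ≤ Real.log 2 := Real.log_nonneg (by norm_num)
    rw [abs_le]
    constructor
    · linarith [abs_nonneg (Real.log (16 * (K ^ h * K ^ h))), abs_nonneg (U n x)]
    · linarith [le_abs_self (Real.log (16 * (K ^ h * K ^ h)))]
  refine ⟨hup, ?_⟩
  have := isLowerExponent_of_isUpperExponent hup
  rwa [neg_zero] at this

/-! ### The family of rotations -/

lemma shift_pow_mem_cylZ {k i : ℕ} {x : Shift2} : (shift ^ i) x ∈ cylZ k ↔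
    (∀ j < k, x ((i + j : ℕ) : ℤ) = 0) ∧ x ((i + k : ℕ) : ℤ) = 1 := by
  simp only [cylZ, mem_ofPred_eq, Finset.mem_range, shift_pow_apply]
  push_cast
  simp only [add_comm]

lemma mem_cylZ {k : ℕ} {x : Shift2} : x ∈ cylZ k ↔
    (∀ j < k, x (j : ℤ) = 0) ∧ x (k : ℤ) = 1 := by
  simp [cylZ]

lemma dependsOn_cylZ (k : ℕ) : DependsOn (· ∈ cylZ k) (window k) := by
  intro x y h
  have hj : ∀ j ≤ k, x (j : ℤ) = y (j : ℤ) := fun j hj => h _ (by simpa [window] using hj)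
  simp only [mem_cylZ, eq_iff_iff]
  refine and_congr (forall₂_congr fun j hjk => ?_) ?_
  · rw [hj j hjk.le]
  · rw [hj k le_rfl]

/-- The closing 1 of one occurrence would fall among the zeros of the next. -/
lemma isTowerBase_cylZ (k : ℕ) : IsTowerBase (cylZ k) k := by
  intro x hx i hi0 hi hxi
  have h1 := (mem_cylZ.mp hx).2
  have h2 := (shift_pow_mem_cylZ.mp hxi).1 (k - i) (by omega)
  rw [Nat.add_sub_cancel' hi.le, h1] at h2
  exact one_ne_zero h2

lemma coe_rotSL (a : ℝ) :
    (rotSL a : Mat2) = !![Real.cos a, -Real.sin a; Real.sin a, Real.cos a] := rfl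

lemma rotSL_mul (a b : ℝ) : rotSL a * rotSL b = rotSL (a + b) := by
  apply Subtype.ext
  ext i j
  fin_cases i <;> fin_cases j <;>
    simp [coe_rotSL, Matrix.mul_apply, Fin.sum_univ_two, Real.cos_add, Real.sin_add] <;> ring

lemma rotSL_pow (a : ℝ) (n : ℕ) : rotSL a ^ n = rotSL (n * a) := by
  induction n with
  | zero =>
    apply Subtype.ext
    ext i j
    rw [pow_zero]
    fin_cases i <;> fin_cases j <;> simp [coe_rotSL]
  | succ n ih =>
    rw [pow_succ, ih, rotSL_mul]; congr 1; push_cast; ring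

lemma cocB_of_mem {σ : ℝ} {hσ : 1 < σ} {k : ℕ} {x : Shift2} (hx : x ∈ tower (cylZ k) 0 k) :
    cocB σ hσ k x = cocA σ hσ x * rotSL (Real.pi / (2 * k)) := glue_of_mem hx

lemma cocB_of_notMem {σ : ℝ} {hσ : 1 < σ} {k : ℕ} {x : Shift2} (hx : x ∉ tower (cylZ k) 0 k) :
    cocB σ hσ k x = cocA σ hσ x := glue_of_notMem hx

lemma fwd_cocB {σ : ℝ} (hσ : 1 < σ) {k : ℕ} {x : Shift2} (hx : x ∈ cylZ k) {n : ℕ} (hn : n ≤ k) :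
    fwd (cocB σ hσ k) n x = rotSL (Real.pi / (2 * k)) ^ n := by
  induction n with
  | zero => rfl
  | succ n ih =>
    have hmem : (shift ^ n) x ∈ tower (cylZ k) 0 k := by
      simp only [tower, mem_iUnion, Finset.mem_Ico]
      exact ⟨n, ⟨Nat.zero_le _, hn⟩, mem_image_of_mem _ hx⟩
    have h0 : (shift ^ n) x 0 ≠ 1 := by
      rw [shift_pow_apply, zero_add, (mem_cylZ.mp hx).1 n hn]
      exact zero_ne_one
    change cocB σ hσ k ((shift ^ n) x) * fwd (cocB σ hσ k) n x = _
    rw [ih (by omega), cocB_of_mem hmem, cocA_apply, if_neg h0, one_mul, ← pow_succ']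

lemma fwd_cocB_top {σ : ℝ} (hσ : 1 < σ) {k : ℕ} (hk : 1 ≤ k) {x : Shift2} (hx : x ∈ cylZ k) :
    fwd (cocB σ hσ k) k x = rotSL (Real.pi / 2) := by
  rw [fwd_cocB hσ hx le_rfl, rotSL_pow]
  congr 1
  have : (k : ℝ) ≠ 0 := by positivity
  field_simp

lemma dependsOn_cocB (σ : ℝ) (hσ : 1 < σ) (k : ℕ) : DependsOn (cocB σ hσ k) (window (2 * k)) := by
  have hA : DependsOn (cocA σ hσ) (window (2 * k)) :=
    (dependsOn_cocA σ hσ).mono (window_mono (Nat.zero_le _))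
  refine dependsOn_glue ?_ (dependsOn_mulConst hA _) hA
  exact (dependsOn_mem_tower (dependsOn_cylZ k) 0 k).mono (window_mono (by omega))

/-- The word `0ᵏ 0 0ᵏ⁻¹ 1 1`, whose symbols at `k` and `2k` may be exchanged. -/
def wordZ (k : ℕ) (hk : 1 ≤ k) : FlipWord where
  l := 2 * k + 2
  a := k
  a' := 2 * k
  w s := if s < 2 * k then 0 else 1
  a_lt := by omega
  a'_lt := by omega
  ne := by
    rw [if_pos (by omega), if_neg (by omega)]
    exact zero_ne_one

/-! ### Effect of an exchange of symbols on the visits to `cylZ k`. -/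

lemma fin_two_eq_one {a : Fin 2} (h : a ≠ 0) : a = 1 := by omega

lemma visitSign_of_iff {W : Set Shift2} {x y : Shift2} (h : y ∈ W ↔ x ∈ W) :
    visitSign W y = visitSign W x := by
  classical
  exact if_congr h rfl rfl

lemma visitSign_of_iff_not {W : Set Shift2} {x y : Shift2} (h : y ∈ W ↔ x ∉ W) :
    visitSign W y = -visitSign W x := by
  unfold visitSign
  by_cases hx : x ∈ W
  · rw [if_pos hx, if_neg fun hy => h.mp hy hx, neg_neg]
  · rw [if_neg hx, if_pos (h.mpr hx)]

/-- Visits to `cylZ k` for a sequence with the word `0ᵏ 0 0ᵏ⁻¹ 1 1` at `b`. -/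
lemma visit_cylZ_of_zero_one {k b : ℕ} (hk : 1 ≤ k) {x : Shift2}
    (h0 : ∀ s < 2 * k, x ((b + s : ℕ) : ℤ) = 0) (h1 : x ((b + 2 * k : ℕ) : ℤ) = 1)
    (h2 : x ((b + (2 * k + 1) : ℕ) : ℤ) = 1) (i : ℕ) :
    (i = b + k → (shift ^ i) x ∈ cylZ k) ∧
    (i = b ∨ i = b + k + 1 → (shift ^ i) x ∉ cylZ k) := by
  simp only [shift_pow_mem_cylZ]
  constructor
  · rintro rfl
    refine ⟨fun j hj => ?_, ?_⟩
    · rw [add_assoc]; exact h0 _ (by omega)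
    · rw [add_assoc, ← two_mul]; exact h1
  · rintro (rfl | rfl) ⟨hz, ho⟩
    · rw [h0 k (by omega)] at ho; exact zero_ne_one ho
    · have := hz (k - 1) (by omega)
      rw [show b + k + 1 + (k - 1) = b + 2 * k by omega, h1] at this
      exact one_ne_zero this

lemma visit_cylZ_of_one_zero {k b : ℕ} {x : Shift2}
    (h0 : ∀ s < 2 * k + 1, s ≠ k → x ((b + s : ℕ) : ℤ) = 0) (h1 : x ((b + k : ℕ) : ℤ) = 1)
    (h2 : x ((b + (2 * k + 1) : ℕ) : ℤ) = 1) (hk : 1 ≤ k) (i : ℕ) :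
    (i = b + k → (shift ^ i) x ∉ cylZ k) ∧
    (i = b ∨ i = b + k + 1 → (shift ^ i) x ∈ cylZ k) := by
  simp only [shift_pow_mem_cylZ]
  constructor
  · rintro rfl ⟨hz, -⟩
    have := hz 0 (by omega)
    rw [add_zero, h1] at this
    exact one_ne_zero this
  · rintro (rfl | rfl)
    · exact ⟨fun j hj => h0 j (by omega) (by omega), h1⟩
    · refine ⟨fun j hj => ?_, ?_⟩
      · rw [show b + k + 1 + j = b + (k + 1 + j) by omega]; exact h0 _ (by omega) (by omega)
      · rw [show b + k + 1 + k = b + (2 * k + 1) by omega]; exact h2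

lemma visit_cylZ_toggle {k b i : ℕ} {u v : Shift2} (hk : 1 ≤ k)
    (hi : i = b ∨ i = b + k ∨ i = b + k + 1)
    (hu : ∀ s < 2 * k, s ≠ k → u ((b + s : ℕ) : ℤ) = 0)
    (hv : ∀ s < 2 * k, s ≠ k → v ((b + s : ℕ) : ℤ) = 0)
    (hu1 : u ((b + (2 * k + 1) : ℕ) : ℤ) = 1) (hv1 : v ((b + (2 * k + 1) : ℕ) : ℤ) = 1)
    (huk : u ((b + k : ℕ) : ℤ) = 0) (hu2k : u ((b + 2 * k : ℕ) : ℤ) = 1)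
    (hvk : v ((b + k : ℕ) : ℤ) = 1) (hv2k : v ((b + 2 * k : ℕ) : ℤ) = 0) :
    (shift ^ i) v ∈ cylZ k ↔ (shift ^ i) u ∉ cylZ k := by
  have hU := visit_cylZ_of_zero_one hk (fun s hs => by
    rcases eq_or_ne s k with rfl | h
    · exact huk
    · exact hu s hs h) hu2k hu1 i
  have hV := visit_cylZ_of_one_zero (fun s hs hsk => by
    rcases eq_or_ne s (2 * k) with rfl | h
    · exact hv2k
    · exact hv s (by omega) hsk) hvk hv1 hk i
  by_cases h : i = b + k
  · exact ⟨fun h' => absurd h' (hV.1 h), fun h' => absurd (hU.1 h) h'⟩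
  · have h' : i = b ∨ i = b + k + 1 := by omega
    exact ⟨fun _ => hU.2 h', fun _ => hV.2 h'⟩

/-- Other visits to `cylZ k` do not depend on the two exchanged symbols. -/
lemma visit_cylZ_congr {k b : ℕ} {x y : Shift2}
    (h0 : ∀ s < 2 * k, s ≠ k → x ((b + s : ℕ) : ℤ) = 0) (h2 : x ((b + (2 * k + 1) : ℕ) : ℤ) = 1)
    (hy : ∀ n : ℕ, n ≠ b + k → n ≠ b + 2 * k → y (n : ℤ) = x (n : ℤ))
    {i : ℕ} (hi : i ≠ b ∧ i ≠ b + k ∧ i ≠ b + k + 1) (hx : (shift ^ i) x ∈ cylZ k) :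
    (shift ^ i) y ∈ cylZ k := by
  rw [shift_pow_mem_cylZ] at hx ⊢
  obtain ⟨hz, ho⟩ := hx
  -- A visit meeting the word elsewhere would end on one of its zeros or have the final 1 of the
  -- word among its own zeros.
  have hfar : i + k < b + k ∨ b + 2 * k + 1 < i := by
    by_contra hcon
    push Not at hcon
    rcases Nat.lt_or_ge i (b + k) with h | h
    · rcases Nat.lt_or_ge (i + k) (b + 2 * k) with h' | h'
      · have := h0 (i + k - b) (by omega) (by omega)
        rw [show b + (i + k - b) = i + k by omega, ho] at this
        exact one_ne_zero this
      · omega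
    · rcases Nat.lt_or_ge (b + 2 * k + 1) (i + k) with h' | h'
      · have := hz (b + (2 * k + 1) - i) (by omega)
        rw [show i + (b + (2 * k + 1) - i) = b + (2 * k + 1) by omega, h2] at this
        exact one_ne_zero this
      · omega
  refine ⟨fun j hj => ?_, ?_⟩
  · rw [hy _ (by omega) (by omega)]; exact hz j hj
  · rw [hy _ (by omega) (by omega)]; exact ho

lemma flips_wordZ {k : ℕ} (hk : 1 ≤ k) : (wordZ k hk).Flips (visitSign (cylZ k)) := by
  classical
  -- `0^{2k} 1 1` has one visit in the block, at `k`; the exchanged word `0^k 1 0^k 1` has two, at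
  -- `0` and `k + 1`. The status changes at all three places, so the parity changes.
  refine ⟨{0, k, k + 1}, ?_, ?_, ?_⟩
  · intro s hs
    simp only [Finset.mem_insert, Finset.mem_singleton] at hs
    change s ∈ Finset.range (2 * k + 2)
    rw [Finset.mem_range]; omega
  · rw [Finset.card_eq_three.mpr ⟨0, k, k + 1, by omega, by omega, by omega, rfl⟩]
    decide
  intro b x hx i
  obtain ⟨hw, hne⟩ := hx
  change x ((b + k : ℕ) : ℤ) ≠ x ((b + 2 * k : ℕ) : ℤ) at hne
  set y := (wordZ k hk).flip b x with hydef
  have hyk : y ((b + k : ℕ) : ℤ) = x ((b + 2 * k : ℕ) : ℤ) := swapCoord_left _ _ _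
  have hy2k : y ((b + 2 * k : ℕ) : ℤ) = x ((b + k : ℕ) : ℤ) := swapCoord_right _ _ _
  have hy : ∀ n : ℕ, n ≠ b + k → n ≠ b + 2 * k → y (n : ℤ) = x (n : ℤ) := fun n h1 h2 =>
    swapCoord_of_ne (by exact_mod_cast h1) (by exact_mod_cast h2) x
  have hx0 : ∀ s < 2 * k, s ≠ k → x ((b + s : ℕ) : ℤ) = 0 := fun s hs hsk => by
    rw [hw s (by change s < 2 * k + 2; omega) hsk (by change s ≠ 2 * k; omega)]
    exact if_pos hs
  have hx1 : x ((b + (2 * k + 1) : ℕ) : ℤ) = 1 := by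
    rw [hw (2 * k + 1) (by change 2 * k + 1 < 2 * k + 2; omega) (by change 2 * k + 1 ≠ k; omega)
      (by change 2 * k + 1 ≠ 2 * k; omega)]
    exact if_neg (by omega)
  have hy0 : ∀ s < 2 * k, s ≠ k → y ((b + s : ℕ) : ℤ) = 0 := fun s hs hsk => by
    rw [hy _ (by omega) (by omega)]; exact hx0 s hs hsk
  have hy1 : y ((b + (2 * k + 1) : ℕ) : ℤ) = 1 := by
    rw [hy _ (by omega) (by omega)]; exact hx1
  have hD : i ∈ ({0, k, k + 1} : Finset ℕ).image (b + ·) ↔ i = b ∨ i = b + k ∨ i = b + k + 1 := by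
    simp only [Finset.mem_image, Finset.mem_insert, Finset.mem_singleton]
    constructor
    · rintro ⟨s, rfl | rfl | rfl, rfl⟩ <;> omega
    · rintro (rfl | rfl | rfl)
      · exact ⟨0, by simp⟩
      · exact ⟨k, by simp⟩
      · exact ⟨k + 1, by simp [add_assoc]⟩
  have hiff : (shift ^ i) y ∈ cylZ k ↔
      if i = b ∨ i = b + k ∨ i = b + k + 1 then (shift ^ i) x ∉ cylZ k
        else (shift ^ i) x ∈ cylZ k := by
    split_ifs with hi
    · have aux := fun u v => visit_cylZ_toggle (u := u) (v := v) hk hi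
      by_cases hxk : x ((b + k : ℕ) : ℤ) = 0
      · have hx2k : x ((b + 2 * k : ℕ) : ℤ) = 1 :=
          fin_two_eq_one fun h => hne (hxk.trans h.symm)
        exact aux x y hx0 hy0 hx1 hy1 hxk hx2k (hyk.trans hx2k) (hy2k.trans hxk)
      · have hxk1 := fin_two_eq_one hxk
        have hx2k : x ((b + 2 * k : ℕ) : ℤ) = 0 := by
          by_contra h
          exact hne (hxk1.trans (fin_two_eq_one h).symm)
        have := aux y x hy0 hx0 hy1 hx1 (hyk.trans hx2k) (hy2k.trans hxk1) hxk1 hx2k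
        exact ⟨fun h h' => this.mp h' h, fun h => not_not.mp fun h' => h (this.mpr h')⟩
    · push Not at hi
      constructor
      · exact visit_cylZ_congr hy0 hy1 (fun n h1 h2 => (hy n h1 h2).symm) hi
      · exact visit_cylZ_congr hx0 hx1 hy hi
  by_cases hi : i = b ∨ i = b + k ∨ i = b + k + 1
  · rw [if_pos hi] at hiff
    rw [if_pos (hD.mpr hi), neg_one_mul, visitSign_of_iff_not hiff]
  · rw [if_neg hi] at hiff
    rw [if_neg (mt hD.mp hi), one_mul, visitSign_of_iff hiff]

lemma coe_rotSL_pi_div_two : (rotSL (Real.pi / 2) : Mat2) = !![0, -1; 1, 0] := by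
  simp [rotSL]

lemma zeroExponents_cocB {p σ : ℝ} (hp0 : 0 < p) (hp1 : p < 1) (hσ : 1 < σ) {k : ℕ} (hk : 1 ≤ k) :
    ZeroExponents p (cocB σ hσ k) :=
  zeroExponents_of_tower hp0 hp1 hσ hk (dependsOn_cylZ k) (isTowerBase_cylZ k)
    (fun _ hx => cocB_of_notMem hx) (by simp [coe_rotSL_pi_div_two])
    (by simp [coe_rotSL_pi_div_two]) (fun _ hx => fwd_cocB_top hσ hk hx) (flips_wordZ hk)

lemma swapsAxes_cocB {σ : ℝ} (hσ : 1 < σ) {k : ℕ} (hk : 1 ≤ k) {x : Shift2} (hx : x ∈ cylZ k) :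
    SwapsAxes (iter (cocB σ hσ k) (k : ℤ) x) := by
  change SwapsAxes (fwd (cocB σ hσ k) k x)
  rw [fwd_cocB_top hσ hk hx]
  exact swapsAxes_of_antidiagonal (by simp [coe_rotSL_pi_div_two]) (by simp [coe_rotSL_pi_div_two])

lemma abs_rotSL_sub_one_le {θ : ℝ} (i j : Fin 2) : |((rotSL θ : Mat2) - 1) i j| ≤ |θ| := by
  have h1 : |Real.cos θ - 1| ≤ |θ| := by
    have hc := Real.one_sub_sq_div_two_le_cos (x := θ)
    have hc1 := Real.cos_le_one θ
    have hc2 := Real.neg_one_le_cos θ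
    rw [abs_of_nonpos (by linarith)]
    have h2 : θ ^ 2 = |θ| ^ 2 := (sq_abs θ).symm
    rcases le_or_gt |θ| 2 with h | h
    · nlinarith [abs_nonneg θ]
    · linarith
  have h2 : |Real.sin θ| ≤ |θ| := Real.abs_sin_le_abs
  fin_cases i <;> fin_cases j <;> simp [rotSL, h1, h2]

lemma abs_one_sub_one_le {η : ℝ} (hη : 0 ≤ η) (i j : Fin 2) :
    |(((1 : SL2) : Mat2) - 1) i j| ≤ η := by
  simpa using hη

lemma tendsto_logDist_cocB {ρ δ σ : ℝ} (hρ0 : 0 < ρ) (hρ1 : ρ < 1) (hδ0 : 0 < δ) (hδ1 : δ < 1)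
    (hσ : 1 < σ) : Tendsto (fun k : ℕ => logDist ρ δ (cocB σ hσ k) (cocA σ hσ)) atTop (𝓝 0) := by
  refine tendsto_logDist_cocA hρ0 hρ1 hδ0 hσ (c := 2)
    (Eventually.of_forall (dependsOn_cocB σ hσ))
    (η := fun k => Real.pi / (2 * k)) (Eventually.of_forall fun k x => ?_) ?_
  · have h0 : 0 ≤ Real.pi / (2 * k) := by positivity
    by_cases hx : x ∈ tower (cylZ k) 0 k
    · refine ⟨_, cocB_of_mem hx, fun i j => ?_⟩
      exact (abs_rotSL_sub_one_le i j).trans_eq (abs_of_nonneg h0)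
    · exact ⟨1, by rw [cocB_of_notMem hx, mul_one], abs_one_sub_one_le h0⟩
  -- The product `η k * k^δ` equals `(π/2) k^{-(1-δ)}`; this is where `δ < 1` enters.
  · have h := ((tendsto_rpow_neg_atTop (sub_pos.mpr hδ1)).comp
      tendsto_natCast_atTop_atTop).const_mul (Real.pi / 2)
    rw [mul_zero] at h
    refine h.congr' ?_
    filter_upwards [eventually_gt_atTop 0] with k hk
    have hk0 : (0 : ℝ) < k := by exact_mod_cast hk
    simp only [Function.comp]
    rw [neg_sub, Real.rpow_sub hk0, Real.rpow_one]
    field_simp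

/-! ### The family of shears, hyperbolic matrices and rotations -/

lemma shift_pow_mem_cylW {k i : ℕ} {x : Shift2} : (shift ^ i) x ∈ cylW k ↔
    (∀ j ≤ k, x ((i + j : ℕ) : ℤ) = 0) ∧
      ∀ j, k < j → j ≤ 2 * k → x ((i + j : ℕ) : ℤ) = 1 := by
  simp only [cylW, mem_ofPred_eq, Finset.mem_range, Finset.mem_Icc, shift_pow_apply, and_imp,
    Nat.lt_succ_iff, Nat.succ_le_iff]
  push_cast
  simp only [add_comm]

lemma mem_cylW {k : ℕ} {x : Shift2} : x ∈ cylW k ↔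
    (∀ j ≤ k, x (j : ℤ) = 0) ∧ ∀ j : ℕ, k < j → j ≤ 2 * k → x (j : ℤ) = 1 := by
  simpa using shift_pow_mem_cylW (k := k) (i := 0) (x := x)

lemma dependsOn_cylW (k : ℕ) : DependsOn (· ∈ cylW k) (window (2 * k)) := by
  intro x y h
  have hj : ∀ j ≤ 2 * k, x (j : ℤ) = y (j : ℤ) := fun j hj => h _ (by simpa [window] using hj)
  simp only [mem_cylW, eq_iff_iff]
  refine and_congr (forall₂_congr fun j hjk => ?_) (forall₃_congr fun j _ hjk => ?_)
  · rw [hj j (by omega)]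
  · rw [hj j hjk]

lemma isTowerBase_cylW (k : ℕ) : IsTowerBase (cylW k) (2 * k + 1) := by
  intro x hx i hi0 hi hxi
  obtain ⟨hx0, hx1⟩ := mem_cylW.mp hx
  have hxi0 := (shift_pow_mem_cylW.mp hxi).1
  rcases Nat.lt_or_ge k i with h | h
  · have := hxi0 0 (Nat.zero_le _)
    rw [add_zero, hx1 i h (by omega)] at this
    exact one_ne_zero this
  · have := hxi0 (k + 1 - i) (by omega)
    rw [show i + (k + 1 - i) = k + 1 by omega, hx1 (k + 1) (by omega) (by omega)] at this
    exact one_ne_zero this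

lemma notMem_tower_of_index {W : Set Shift2} {h : ℕ} (hW : IsTowerBase W h) {x : Shift2} {i : ℕ}
    (hi : i < h) (hx : x ∈ (shift ^ i : Equiv.Perm Shift2) '' W) {a b : ℕ} (hb : b ≤ h)
    (hab : i < a ∨ b ≤ i) : x ∉ tower W a b := by
  intro hxt
  simp only [tower, mem_iUnion, Finset.mem_Ico] at hxt
  obtain ⟨j, ⟨hja, hjb⟩, hxj⟩ := hxt
  have := hW.index_unique hi (by omega) hx hxj
  omega

section Levels

variable {σ : ℝ} {hσ : 1 < σ} {β : ℝ} {k : ℕ} {x : Shift2}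

lemma cocL_of_notMem (hk : 2 ≤ k) (hx : x ∉ tower (cylW k) 0 (2 * k + 1)) :
    cocL σ hσ β k x = cocA σ hσ x := by
  have hlev : ∀ i < 2 * k + 1, x ∉ (shift ^ i : Equiv.Perm Shift2) '' cylW k := fun i hi hxi =>
    hx (by simp only [tower, mem_iUnion, Finset.mem_Ico]; exact ⟨i, ⟨Nat.zero_le _, hi⟩, hxi⟩)
  have ht : x ∉ tower (cylW k) 1 (k + 1) := fun hxt => by
    simp only [tower, mem_iUnion, Finset.mem_Ico] at hxt
    obtain ⟨j, ⟨hja, hjb⟩, hxj⟩ := hxt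
    exact hlev j (by omega) hxj
  rw [cocL, glue_of_notMem (by simpa using hlev 0 (by omega)), glue_of_notMem ht,
    glue_of_notMem (hlev (k + 1) (by omega)), glue_of_notMem (hlev (2 * k) (by omega))]

lemma cocL_base (hx : x ∈ cylW k) :
    cocL σ hσ β k x = cocA σ hσ x * shearSL (small β k) := glue_of_mem hx

lemma notMem_cylW_of_index {i : ℕ} (hi0 : 0 < i) (hi : i < 2 * k + 1)
    (hx : x ∈ (shift ^ i : Equiv.Perm Shift2) '' cylW k) : x ∉ cylW k := fun hxW => by
  have := (isTowerBase_cylW k).index_unique hi (Nat.succ_pos _) hx (j := 0) (by simpa using hxW)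
  omega

lemma cocL_diag {i : ℕ} (hi0 : 0 < i) (hi : i ≤ k)
    (hx : x ∈ (shift ^ i : Equiv.Perm Shift2) '' cylW k) :
    cocL σ hσ β k x = cocA σ hσ x *
      diagSL (1 + small β k)⁻¹ (inv_pos.mpr (one_add_small_pos β k)) := by
  have ht : x ∈ tower (cylW k) 1 (k + 1) := by
    simp only [tower, mem_iUnion, Finset.mem_Ico]
    exact ⟨i, ⟨hi0, by omega⟩, hx⟩
  rw [cocL, glue_of_notMem (notMem_cylW_of_index hi0 (by omega) hx), glue_of_mem ht]
  rfl

lemma cocL_rot (hk : 2 ≤ k)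
    (hx : x ∈ (shift ^ (k + 1) : Equiv.Perm Shift2) '' cylW k) :
    cocL σ hσ β k x = cocA σ hσ x * rotSL (angle β k) := by
  rw [cocL, glue_of_notMem (notMem_cylW_of_index (by omega) (by omega) hx),
    glue_of_notMem (notMem_tower_of_index (isTowerBase_cylW k) (by omega) hx (by omega)
      (Or.inr le_rfl)), glue_of_mem hx]
  rfl

lemma cocL_last (hk : 2 ≤ k)
    (hx : x ∈ (shift ^ (2 * k) : Equiv.Perm Shift2) '' cylW k) :
    cocL σ hσ β k x = cocA σ hσ x * shearSL (lastShear σ β k) := by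
  have hx' : x ∉ (shift ^ (k + 1) : Equiv.Perm Shift2) '' cylW k := fun h => by
    have := (isTowerBase_cylW k).index_unique (by omega) (by omega) hx h
    omega
  rw [cocL, glue_of_notMem (notMem_cylW_of_index (by omega) (by omega) hx),
    glue_of_notMem (notMem_tower_of_index (isTowerBase_cylW k) (by omega) hx (by omega)
      (Or.inr (by omega))), glue_of_notMem hx', glue_of_mem hx]
  rfl

lemma cocL_free {i : ℕ} (hi0 : k + 1 < i) (hi : i < 2 * k)
    (hx : x ∈ (shift ^ i : Equiv.Perm Shift2) '' cylW k) :
    cocL σ hσ β k x = cocA σ hσ x := by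
  have hx' : ∀ j < 2 * k + 1, j ≠ i → x ∉ (shift ^ j : Equiv.Perm Shift2) '' cylW k :=
    fun j hj hji h => hji ((isTowerBase_cylW k).index_unique hj (by omega) h hx)
  rw [cocL, glue_of_notMem (notMem_cylW_of_index (by omega) (by omega) hx),
    glue_of_notMem (notMem_tower_of_index (isTowerBase_cylW k) (by omega) hx (by omega)
      (Or.inr (by omega))), glue_of_notMem (hx' _ (by omega) (by omega)),
    glue_of_notMem (hx' _ (by omega) (by omega))]

end Levels

lemma small_pos {β : ℝ} {k : ℕ} (hk : 0 < k) : 0 < small β k :=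
  Real.rpow_pos_of_pos (by exact_mod_cast hk) _

/-! ### The matrix of the passage through the tower over `cylW k`. -/

lemma cos_angle {β : ℝ} {k : ℕ} (hk : 0 < k) :
    Real.cos (angle β k) =
      Real.sin (angle β k) * (small β k * (1 + small β k) ^ (2 * k)) := by
  have ha := small_pos (β := β) hk
  have h1 := one_add_small_pos β k
  have hc : Real.cos (angle β k) ≠ 0 := (Real.cos_arctan_pos _).ne'
  have ht : Real.tan (angle β k) = 1 / (small β k * (1 + small β k) ^ (2 * k)) :=
    Real.tan_arctan _
  rw [Real.tan_eq_sin_div_cos] at ht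
  field_simp at ht
  linarith

/-- The matrix of the passage through the tower over `cylW k`. -/
noncomputable def passageL (σ : ℝ) (hσ : 1 < σ) (β : ℝ) (k : ℕ) : SL2 :=
  diagSL σ (one_pos.trans hσ) * shearSL (lastShear σ β k) *
    (diagSL σ (one_pos.trans hσ) ^ (k - 2) * (diagSL σ (one_pos.trans hσ) * rotSL (angle β k) *
      (diagSL (1 + small β k)⁻¹ (inv_pos.mpr (one_add_small_pos β k)) ^ k *
        shearSL (small β k))))

lemma fwd_cocL {σ : ℝ} (hσ : 1 < σ) (β : ℝ) {k : ℕ} (hk : 2 ≤ k) {x : Shift2} (hx : x ∈ cylW k) :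
    fwd (cocL σ hσ β k) (2 * k + 1) x = passageL σ hσ β k := by
  obtain ⟨hx0, hx1⟩ := mem_cylW.mp hx
  have hA0 : ∀ i ≤ k, cocA σ hσ ((shift ^ i) x) = 1 := fun i hi => by
    rw [cocA_apply, shift_pow_apply, zero_add, hx0 i hi, if_neg zero_ne_one]
  have hA1 : ∀ i, k < i → i ≤ 2 * k →
      cocA σ hσ ((shift ^ i) x) = diagSL σ (one_pos.trans hσ) := fun i hi hi' => by
    rw [cocA_apply, shift_pow_apply, zero_add, hx1 i hi hi', if_pos rfl]
  have hmem : ∀ i, (shift ^ i) x ∈ (shift ^ i : Equiv.Perm Shift2) '' cylW k := fun i =>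
    mem_image_of_mem _ hx
  have hs : ∀ n, fwd (cocL σ hσ β k) (n + 1) x =
      cocL σ hσ β k ((shift ^ n) x) * fwd (cocL σ hσ β k) n x := fun _ => rfl
  have h1 : ∀ n ≤ k, fwd (cocL σ hσ β k) (n + 1) x =
      diagSL (1 + small β k)⁻¹ (inv_pos.mpr (one_add_small_pos β k)) ^ n *
        shearSL (small β k) := by
    intro n hn
    induction n with
    | zero =>
      rw [hs, cocL_base (by simpa using hx), hA0 0 (Nat.zero_le _)]
      simp [fwd]
    | succ n ih =>
      rw [hs, ih (by omega), cocL_diag (Nat.succ_pos n) hn (hmem _), hA0 _ hn, one_mul,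
        pow_succ', mul_assoc]
  -- Levels `k + 2, …, 2k - 1` are unperturbed and read the symbol 1; for `k = 2` there are none.
  have h2 : ∀ n, n + 2 ≤ k → fwd (cocL σ hσ β k) (k + 2 + n) x =
      diagSL σ (one_pos.trans hσ) ^ n * (diagSL σ (one_pos.trans hσ) * rotSL (angle β k) *
        (diagSL (1 + small β k)⁻¹ (inv_pos.mpr (one_add_small_pos β k)) ^ k *
          shearSL (small β k))) := by
    intro n hn
    induction n with
    | zero =>
      rw [add_zero, hs, h1 k le_rfl, cocL_rot hk (hmem _), hA1 _ (by omega) (by omega), pow_zero,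
        one_mul]
    | succ n ih =>
      rw [← add_assoc, hs, ih (by omega), cocL_free (by omega) (by omega) (hmem _),
        hA1 _ (by omega) (by omega), pow_succ']
      simp only [mul_assoc]
  have h3 := h2 (k - 2) (by omega)
  rw [show k + 2 + (k - 2) = 2 * k by omega] at h3
  rw [hs, h3, cocL_last hk (hmem _), hA1 _ (by omega) le_rfl, passageL]

lemma coe_shearSL (a : ℝ) : (shearSL a : Mat2) = !![1, 0; a, 1] := rfl

/-- The first axis is tilted by the shear and steepened by `diag(b, b⁻¹)` to slope `a / b²`, then
turned by `θ` exactly onto the second axis, which the later factors preserve. The second axis is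
kept until the rotation, then flattened by `diag(T, T⁻¹)` to slope `-a / (b² T²) = -γ`, which the
last shear cancels. -/
lemma antidiagonal_of_relations {σ T b θ a γ : ℝ} (hσ : 0 < σ) (hT : 0 < T) (hb : 0 < b)
    (hθ : Real.cos θ * b ^ 2 = Real.sin θ * a) (hγ : γ * T ^ 2 * b ^ 2 = a) :
    let q := diagSL σ hσ * shearSL γ * (diagSL T hT * rotSL θ * (diagSL b hb * shearSL a))
    (q : Mat2) 0 0 = 0 ∧ (q : Mat2) 1 1 = 0 := by
  constructor
  · simp [coe_diagSL, coe_shearSL, coe_rotSL, Matrix.mul_apply, Fin.sum_univ_two]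
    right
    field_simp
    linear_combination T * hθ
  · simp [coe_diagSL, coe_shearSL, coe_rotSL, Matrix.mul_apply, Fin.sum_univ_two]
    field_simp
    have hb2 : b ^ 2 ≠ 0 := by positivity
    apply mul_left_cancel₀ hb2
    linear_combination hθ - Real.sin θ * hγ

lemma passageL_antidiagonal {σ : ℝ} (hσ : 1 < σ) (β : ℝ) {k : ℕ} (hk : 2 ≤ k) :
    (passageL σ hσ β k : Mat2) 0 0 = 0 ∧ (passageL σ hσ β k : Mat2) 1 1 = 0 := by
  have h0 : 0 < σ := one_pos.trans hσ
  have h1 := one_add_small_pos β k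
  have e : passageL σ hσ β k = diagSL σ h0 * shearSL (lastShear σ β k) *
      (diagSL (σ ^ (k - 1)) (pow_pos h0 _) * rotSL (angle β k) *
        (diagSL ((1 + small β k)⁻¹ ^ k) (pow_pos (inv_pos.mpr h1) _) * shearSL (small β k))) := by
    have e1 : diagSL (σ ^ (k - 1)) (pow_pos h0 _) = diagSL σ h0 ^ (k - 2) * diagSL σ h0 := by
      rw [← pow_succ, show k - 2 + 1 = k - 1 by omega, diagSL_pow]
    rw [passageL, e1, ← diagSL_pow (inv_pos.mpr h1)]
    simp only [mul_assoc]
  rw [e]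
  refine antidiagonal_of_relations h0 _ _ ?_ ?_
  · rw [cos_angle (by omega), ← pow_mul, mul_comm k 2, inv_pow]
    field_simp
  · rw [lastShear, ← pow_mul, ← pow_mul, mul_comm k 2, inv_pow,
      show (k - 1) * 2 = 2 * k - 2 by omega]
    field_simp

/-- The word `0ᵏ⁺¹ 1ᵏ⁻¹ 1 0 0 1`, whose symbols at `2k` and `2k + 2` may be exchanged. -/
def wordW (k : ℕ) : FlipWord where
  l := 2 * k + 4
  a := 2 * k
  a' := 2 * k + 2
  -- The clause `s < 2 * k` matters only for `k = 0`, where it keeps the two distinguished symbols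
  -- different.
  w s := if s ≤ k ∧ s < 2 * k ∨ s = 2 * k + 1 ∨ s = 2 * k + 2 then 0 else 1
  a_lt := by omega
  a'_lt := by omega
  ne := by
    rw [if_neg (by omega), if_pos (by omega)]
    exact one_ne_zero

/-- A visit needs `k + 1 ≥ 3` initial zeros. Starting in the block after `b`, these would meet a
fixed 1 or contain both exchanged symbols, which differ. A visit starting before `b` ends before the
first of them. -/
lemma visit_cylW_congr {k b : ℕ} (hk : 2 ≤ k) {x y : Shift2}
    (h1 : ∀ s, k < s → s < 2 * k → x ((b + s : ℕ) : ℤ) = 1)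
    (h3 : x ((b + (2 * k + 3) : ℕ) : ℤ) = 1)
    (hne : x ((b + 2 * k : ℕ) : ℤ) ≠ x ((b + (2 * k + 2) : ℕ) : ℤ))
    (hy : ∀ n : ℕ, n ≠ b + 2 * k → n ≠ b + (2 * k + 2) → y (n : ℤ) = x (n : ℤ))
    {i : ℕ} (hi : i ≠ b) (hx : (shift ^ i) x ∈ cylW k) : (shift ^ i) y ∈ cylW k := by
  rw [shift_pow_mem_cylW] at hx ⊢
  obtain ⟨hz, ho⟩ := hx
  have hzero : ∀ s, i ≤ b + s → b + s ≤ i + k → x ((b + s : ℕ) : ℤ) = 0 := fun s hs hs' => by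
    have := hz (b + s - i) (by omega)
    rwa [show i + (b + s - i) = b + s by omega] at this
  have hfar : i < b ∨ b + 2 * k + 2 < i := by
    by_contra hcon
    push Not at hcon
    rcases Nat.lt_or_ge i (b + k + 2) with h | h
    · have := hzero (k + 1) (by omega) (by omega)
      rw [h1 (k + 1) (by omega) (by omega)] at this
      exact one_ne_zero this
    rcases Nat.lt_or_ge i (b + 2 * k) with h' | h'
    · have := hzero (i - b) (by omega) (by omega)
      rw [h1 (i - b) (by omega) (by omega)] at this
      exact one_ne_zero this
    rcases Nat.lt_or_ge (b + 2 * k) i with h'' | h''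
    · have := hzero (2 * k + 3) (by omega) (by omega)
      rw [h3] at this
      exact one_ne_zero this
    · exact hne ((hzero (2 * k) (by omega) (by omega)).trans
        (hzero (2 * k + 2) (by omega) (by omega)).symm)
  refine ⟨fun j hj => ?_, fun j hj hj' => ?_⟩
  · rw [hy _ (by omega) (by omega)]; exact hz j hj
  · rw [hy _ (by omega) (by omega)]; exact ho j hj hj'

lemma visit_cylW_iff {k b : ℕ} (hk : 2 ≤ k) {x : Shift2}
    (h0 : ∀ s ≤ k, x ((b + s : ℕ) : ℤ) = 0)
    (h1 : ∀ s, k < s → s < 2 * k → x ((b + s : ℕ) : ℤ) = 1) :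
    (shift ^ b) x ∈ cylW k ↔ x ((b + 2 * k : ℕ) : ℤ) = 1 := by
  rw [shift_pow_mem_cylW]
  refine ⟨fun h => h.2 (2 * k) (by omega) le_rfl, fun h => ⟨h0, fun j hj hj' => ?_⟩⟩
  rcases hj'.lt_or_eq with hlt | rfl
  · exact h1 j hj hlt
  · exact h

lemma flips_wordW {k : ℕ} (hk : 2 ≤ k) : (wordW k).Flips (visitSign (cylW k)) := by
  -- The exchange decides the last symbol of the visit at `b`, and no other visit changes.
  refine ⟨{0}, ?_, by simp, ?_⟩
  · rw [Finset.singleton_subset_iff, Finset.mem_range]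
    change 0 < 2 * k + 4
    omega
  intro b x hx i
  obtain ⟨hw, hne⟩ := hx
  change x ((b + 2 * k : ℕ) : ℤ) ≠ x ((b + (2 * k + 2) : ℕ) : ℤ) at hne
  change ∀ s < 2 * k + 4, s ≠ 2 * k → s ≠ 2 * k + 2 → x ((b + s : ℕ) : ℤ) =
    if s ≤ k ∧ s < 2 * k ∨ s = 2 * k + 1 ∨ s = 2 * k + 2 then 0 else 1 at hw
  set y := (wordW k).flip b x with hydef
  have hya : y ((b + 2 * k : ℕ) : ℤ) = x ((b + (2 * k + 2) : ℕ) : ℤ) := swapCoord_left _ _ _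
  have hya' : y ((b + (2 * k + 2) : ℕ) : ℤ) = x ((b + 2 * k : ℕ) : ℤ) := swapCoord_right _ _ _
  have hy : ∀ n : ℕ, n ≠ b + 2 * k → n ≠ b + (2 * k + 2) → y (n : ℤ) = x (n : ℤ) :=
    fun n h1 h2 => swapCoord_of_ne (by exact_mod_cast h1) (by exact_mod_cast h2) x
  have hx0 : ∀ s ≤ k, x ((b + s : ℕ) : ℤ) = 0 := fun s hs => by
    rw [hw s (by omega) (by omega) (by omega), if_pos (by omega)]
  have hx1 : ∀ s, k < s → s < 2 * k → x ((b + s : ℕ) : ℤ) = 1 := fun s hs hs' => by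
    rw [hw s (by omega) (by omega) (by omega), if_neg (by omega)]
  have hx3 : x ((b + (2 * k + 3) : ℕ) : ℤ) = 1 := by
    rw [hw _ (by omega) (by omega) (by omega), if_neg (by omega)]
  have hy0 : ∀ s ≤ k, y ((b + s : ℕ) : ℤ) = 0 := fun s hs => by
    rw [hy _ (by omega) (by omega)]; exact hx0 s hs
  have hy1 : ∀ s, k < s → s < 2 * k → y ((b + s : ℕ) : ℤ) = 1 := fun s hs hs' => by
    rw [hy _ (by omega) (by omega)]; exact hx1 s hs hs'
  have hy3 : y ((b + (2 * k + 3) : ℕ) : ℤ) = 1 := by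
    rw [hy _ (by omega) (by omega)]; exact hx3
  have hD : i ∈ ({0} : Finset ℕ).image (b + ·) ↔ i = b := by simp
  by_cases hi : i = b
  · subst hi
    rw [if_pos (hD.mpr rfl), neg_one_mul]
    refine visitSign_of_iff_not ?_
    rw [visit_cylW_iff hk hy0 hy1, visit_cylW_iff hk hx0 hx1, hya]
    constructor
    · exact fun h h' => hne (h'.trans h.symm)
    · intro h
      refine fin_two_eq_one fun h' => hne ?_
      have h4 : x ((i + 2 * k : ℕ) : ℤ) = 0 := by
        by_contra h5
        exact h (fin_two_eq_one h5)
      exact h4.trans h'.symm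
  · rw [if_neg (mt hD.mp hi), one_mul]
    refine visitSign_of_iff ⟨?_, visit_cylW_congr hk hx1 hx3 hne hy hi⟩
    exact visit_cylW_congr hk hy1 hy3 (by rw [hya, hya']; exact hne.symm)
      (fun n h1 h2 => (hy n h1 h2).symm) hi

lemma zeroExponents_cocL {p σ : ℝ} (hp0 : 0 < p) (hp1 : p < 1) (hσ : 1 < σ) (β : ℝ) {k : ℕ}
    (hk : 2 ≤ k) : ZeroExponents p (cocL σ hσ β k) :=
  zeroExponents_of_tower hp0 hp1 hσ (Nat.succ_pos _) (dependsOn_cylW k) (isTowerBase_cylW k)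
    (fun _ hx => cocL_of_notMem hk hx) (passageL_antidiagonal hσ β hk).1
    (passageL_antidiagonal hσ β hk).2 (fun _ hx => fwd_cocL hσ β hk hx) (flips_wordW hk)

lemma swapsAxes_cocL {σ : ℝ} (hσ : 1 < σ) (β : ℝ) {k : ℕ} (hk : 2 ≤ k) {x : Shift2}
    (hx : x ∈ cylW k) : SwapsAxes (iter (cocL σ hσ β k) (2 * (k : ℤ) + 1) x) := by
  have e : iter (cocL σ hσ β k) (2 * (k : ℤ) + 1) x = passageL σ hσ β k := by
    rw [← fwd_cocL hσ β hk hx, show 2 * (k : ℤ) + 1 = ((2 * k + 1 : ℕ) : ℤ) by push_cast; rfl]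
    rfl
  rw [e]
  exact swapsAxes_of_antidiagonal (passageL_antidiagonal hσ β hk).1
    (passageL_antidiagonal hσ β hk).2

lemma dependsOn_cocL (σ : ℝ) (hσ : 1 < σ) (β : ℝ) {k : ℕ} (hk : 1 ≤ k) :
    DependsOn (cocL σ hσ β k) (window (4 * k)) := by
  have hA : DependsOn (cocA σ hσ) (window (4 * k)) :=
    (dependsOn_cocA σ hσ).mono (window_mono (Nat.zero_le _))
  have hW := dependsOn_cylW k
  refine dependsOn_glue (hW.mono (window_mono (by omega))) (dependsOn_mulConst hA _) ?_
  refine dependsOn_glue ((dependsOn_mem_tower hW 1 (k + 1)).mono (window_mono (by omega)))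
    (dependsOn_mulConst hA _) ?_
  refine dependsOn_glue ((dependsOn_mem_image hW (k + 1)).mono (window_mono (by omega)))
    (dependsOn_mulConst hA _) ?_
  exact dependsOn_glue ((dependsOn_mem_image hW (2 * k)).mono (window_mono (by omega)))
    (dependsOn_mulConst hA _) hA

/-! ### Size of the second perturbation -/

lemma small_mul_rpow {β δ : ℝ} {k : ℕ} (hk : 0 < k) :
    small β k * (k : ℝ) ^ δ = (k : ℝ) ^ (-(β - δ)) := by
  have hk0 : (0 : ℝ) < k := by exact_mod_cast hk
  rw [small, ← Real.rpow_add hk0]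
  congr 1; ring

lemma tendsto_small {β : ℝ} (hβ : 0 < β) : Tendsto (small β) atTop (𝓝 0) :=
  (tendsto_rpow_neg_atTop hβ).comp tendsto_natCast_atTop_atTop

lemma small_le_one {β : ℝ} (hβ : 0 < β) {k : ℕ} (hk : 0 < k) : small β k ≤ 1 :=
  Real.rpow_le_one_of_one_le_of_nonpos (by exact_mod_cast hk) (by linarith)

/-- For `0 ≤ a ≤ 1` one has `e^a ≤ 1 + a + a² ≤ (1 + a)²`; take the `k`-th power with `a = k^{-β}`,
so that `k a = k^{1-β}`. -/
lemma exp_rpow_le {β : ℝ} (hβ : 0 < β) {k : ℕ} (hk : 0 < k) :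
    Real.exp ((k : ℝ) ^ (1 - β)) ≤ (1 + small β k) ^ (2 * k) := by
  have ha0 := small_nonneg β k
  have ha1 := small_le_one hβ hk
  have h1 : Real.exp (small β k) ≤ (1 + small β k) ^ 2 := by
    have := (abs_le.mp (Real.abs_exp_sub_one_sub_id_le (x := small β k)
      (by rwa [abs_of_nonneg ha0]))).2
    nlinarith
  have hk0 : (0 : ℝ) < k := by exact_mod_cast hk
  have h2 : (k : ℝ) ^ (1 - β) = k * small β k := by
    rw [small, sub_eq_add_neg, Real.rpow_add hk0, Real.rpow_one]
  rw [h2, Real.exp_nat_mul, pow_mul]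
  exact pow_le_pow_left₀ (Real.exp_pos _).le h1 k

/-- The quantity is at most `k^{β+δ} exp(-k^{1-β})`. Here `β < 1` is essential: it makes the small
hyperbolic factors accumulate enough for the rotation angle to be tiny. -/
lemma tendsto_inv_growth {β δ : ℝ} (hβ0 : 0 < β) (hβ1 : β < 1) :
    Tendsto (fun k : ℕ => 1 / (small β k * (1 + small β k) ^ (2 * k)) * (k : ℝ) ^ δ) atTop
      (𝓝 0) := by
  have hlim : Tendsto (fun k : ℕ => ((k : ℝ) ^ (1 - β)) ^ ((β + δ) / (1 - β)) *
      Real.exp (-1 * (k : ℝ) ^ (1 - β))) atTop (𝓝 0) :=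
    (tendsto_rpow_mul_exp_neg_mul_atTop_nhds_zero ((β + δ) / (1 - β)) 1 one_pos).comp
      ((tendsto_rpow_atTop (sub_pos.mpr hβ1)).comp tendsto_natCast_atTop_atTop)
  refine tendsto_of_tendsto_of_tendsto_of_le_of_le' tendsto_const_nhds hlim ?_ ?_
  · exact Eventually.of_forall fun k => by
      have := small_nonneg β k
      positivity
  · filter_upwards [eventually_gt_atTop 0] with k hk
    have hk0 : (0 : ℝ) < k := by exact_mod_cast hk
    have h1 : (0 : ℝ) < 1 - β := sub_pos.mpr hβ1
    have e1 : ((k : ℝ) ^ (1 - β)) ^ ((β + δ) / (1 - β)) = (k : ℝ) ^ β * (k : ℝ) ^ δ := by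
      rw [← Real.rpow_mul hk0.le, mul_div_cancel₀ _ h1.ne', Real.rpow_add hk0]
    have e2 : (small β k)⁻¹ = (k : ℝ) ^ β := by
      rw [small, Real.rpow_neg hk0.le, inv_inv]
    have h2 : ((1 + small β k) ^ (2 * k))⁻¹ ≤ Real.exp (-1 * (k : ℝ) ^ (1 - β)) := by
      rw [neg_one_mul, Real.exp_neg]
      exact inv_anti₀ (Real.exp_pos _) (exp_rpow_le hβ0 hk)
    rw [one_div, mul_inv, e2, e1]
    calc (k : ℝ) ^ β * ((1 + small β k) ^ (2 * k))⁻¹ * (k : ℝ) ^ δ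
        = (k : ℝ) ^ β * (k : ℝ) ^ δ * ((1 + small β k) ^ (2 * k))⁻¹ := by ring
      _ ≤ _ := by gcongr

lemma lastShear_nonneg {σ : ℝ} (hσ : 1 < σ) (β : ℝ) (k : ℕ) : 0 ≤ lastShear σ β k := by
  have := small_nonneg β k
  have : 0 < σ := one_pos.trans hσ
  unfold lastShear
  positivity

lemma tendsto_lastShear {σ β δ : ℝ} (hσ : 1 < σ) (hβ : 0 < β) (hδ : δ < 1) :
    Tendsto (fun k : ℕ => lastShear σ β k * (k : ℝ) ^ δ) atTop (𝓝 0) := by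
  have h0 : 0 < σ := one_pos.trans hσ
  -- Once `1 + a_k` is below the midpoint of `1` and `σ`, the ratio `(1 + a_k) / σ` is at most `r <
  -- 1`, and the shear decays like `r^{2k}`.
  set r := (1 + σ) / (2 * σ) with hr
  have hr0 : 0 ≤ r := by positivity
  have hr1 : r < 1 := by rw [hr, div_lt_one (by positivity)]; linarith
  have hlim : Tendsto (fun k : ℕ => σ ^ 2 * ((k : ℝ) * (r ^ 2) ^ k)) atTop (𝓝 0) := by
    have := (tendsto_self_mul_const_pow_of_lt_one (sq_nonneg r)
      (pow_lt_one₀ hr0 hr1 two_ne_zero)).const_mul (σ ^ 2)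
    rwa [mul_zero] at this
  refine tendsto_of_tendsto_of_tendsto_of_le_of_le' tendsto_const_nhds hlim
    (Eventually.of_forall fun k => mul_nonneg (lastShear_nonneg hσ β k) (by positivity)) ?_
  have hs : ∀ᶠ k in atTop, small β k < (σ - 1) / 2 :=
    (tendsto_small hβ).eventually_lt_const (by linarith)
  filter_upwards [hs, eventually_gt_atTop 0] with k hk hk0
  have ha0 := small_nonneg β k
  have ha1 := small_le_one hβ hk0
  have e : lastShear σ β k = small β k * (σ ^ 2 * (((1 + small β k) / σ) ^ 2) ^ k) := by
    have e1 : σ ^ (2 * k) = σ ^ (2 * k - 2) * σ ^ 2 := by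
      rw [← pow_add]; congr 1; omega
    rw [lastShear, ← pow_mul, div_pow, e1]
    field_simp
  have h1 : (1 + small β k) / σ ≤ r := by
    rw [hr, div_le_div_iff₀ h0 (by positivity)]
    nlinarith
  have h2 : (k : ℝ) ^ δ ≤ k := by
    have := Real.rpow_le_rpow_of_exponent_le (x := (k : ℝ)) (by exact_mod_cast hk0) hδ.le
    rwa [Real.rpow_one] at this
  have h3 : (((1 + small β k) / σ) ^ 2) ^ k ≤ (r ^ 2) ^ k := by
    have : 0 ≤ (1 + small β k) / σ := by positivity
    gcongr
  rw [e]
  calc small β k * (σ ^ 2 * (((1 + small β k) / σ) ^ 2) ^ k) * (k : ℝ) ^ δ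
      ≤ 1 * (σ ^ 2 * (r ^ 2) ^ k) * k := by gcongr
    _ = _ := by ring

lemma abs_shearSL_sub_one_le {a : ℝ} (ha : 0 ≤ a) (i j : Fin 2) :
    |((shearSL a : Mat2) - 1) i j| ≤ a := by
  fin_cases i <;> fin_cases j <;> simp [coe_shearSL, abs_of_nonneg ha, ha]

lemma abs_diagSL_sub_one_le {a : ℝ} (ha : 0 ≤ a) (h : 0 < (1 + a)⁻¹) (i j : Fin 2) :
    |((diagSL (1 + a)⁻¹ h : Mat2) - 1) i j| ≤ a := by
  have h1 : |(1 + a)⁻¹ - 1| ≤ a := by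
    have h2 : (1 + a)⁻¹ - 1 = -(a / (1 + a)) := by field_simp; ring
    rw [h2, abs_neg, abs_of_nonneg (by positivity)]
    exact div_le_self ha (by linarith)
  fin_cases i <;> fin_cases j <;> simp [coe_diagSL, abs_of_nonneg ha, ha, h1]

lemma abs_angle_le (β : ℝ) (k : ℕ) :
    |angle β k| ≤ 1 / (small β k * (1 + small β k) ^ (2 * k)) := by
  have ha := small_nonneg β k
  have h0 : 0 ≤ 1 / (small β k * (1 + small β k) ^ (2 * k)) := by positivity
  rw [angle, abs_of_nonneg (Real.arctan_nonneg.mpr h0)]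
  have h := Real.le_tan (Real.arctan_nonneg.mpr h0) (Real.arctan_lt_pi_div_two _)
  rwa [Real.tan_arctan] at h

lemma tendsto_logDist_cocL {ρ δ σ β : ℝ} (hρ0 : 0 < ρ) (hρ1 : ρ < 1) (hδ0 : 0 < δ) (hσ : 1 < σ)
    (hδβ : δ < β) (hβ1 : β < 1) :
    Tendsto (fun k : ℕ => logDist ρ δ (cocL σ hσ β k) (cocA σ hσ)) atTop (𝓝 0) := by
  have hβ0 : 0 < β := hδ0.trans hδβ
  refine tendsto_logDist_cocA hρ0 hρ1 hδ0 hσ (c := 4)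
    (η := fun k => small β k + 1 / (small β k * (1 + small β k) ^ (2 * k)) + lastShear σ β k)
    ?_ ?_ ?_
  · filter_upwards [eventually_ge_atTop 1] with k hk
    exact dependsOn_cocL σ hσ β hk
  · refine Eventually.of_forall fun k x => ?_
    have ha := small_nonneg β k
    have hu : 0 ≤ 1 / (small β k * (1 + small β k) ^ (2 * k)) := by positivity
    have hγ := lastShear_nonneg hσ β k
    by_cases h1 : x ∈ cylW k
    · refine ⟨_, glue_of_mem h1, fun i j => (abs_shearSL_sub_one_le ha i j).trans ?_⟩
      linarith
    by_cases h2 : x ∈ tower (cylW k) 1 (k + 1)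
    · refine ⟨_, (glue_of_notMem h1).trans (glue_of_mem h2),
        fun i j => (abs_diagSL_sub_one_le ha _ i j).trans ?_⟩
      linarith
    by_cases h3 : x ∈ (shift ^ (k + 1) : Equiv.Perm Shift2) '' cylW k
    · refine ⟨_, (glue_of_notMem h1).trans ((glue_of_notMem h2).trans (glue_of_mem h3)),
        fun i j => (abs_rotSL_sub_one_le i j).trans ((abs_angle_le β k).trans ?_)⟩
      linarith
    by_cases h4 : x ∈ (shift ^ (2 * k) : Equiv.Perm Shift2) '' cylW k
    · refine ⟨_, (glue_of_notMem h1).trans ((glue_of_notMem h2).trans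
        ((glue_of_notMem h3).trans (glue_of_mem h4))),
        fun i j => (abs_shearSL_sub_one_le hγ i j).trans ?_⟩
      linarith
    · refine ⟨1, ?_, abs_one_sub_one_le (by positivity)⟩
      rw [mul_one]
      exact (glue_of_notMem h1).trans ((glue_of_notMem h2).trans
        ((glue_of_notMem h3).trans (glue_of_notMem h4)))
  · have h1 : Tendsto (fun k : ℕ => small β k * (k : ℝ) ^ δ) atTop (𝓝 0) := by
      refine ((tendsto_rpow_neg_atTop (sub_pos.mpr hδβ)).comp
        tendsto_natCast_atTop_atTop).congr' ?_
      filter_upwards [eventually_gt_atTop 0] with k hk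
      exact (small_mul_rpow hk).symm
    have h := (h1.add (tendsto_inv_growth (δ := δ) hβ0 hβ1)).add
      (tendsto_lastShear (δ := δ) hσ hβ0 (hδβ.trans hβ1))
    rw [add_zero, add_zero] at h
    refine h.congr fun k => ?_
    ring

end LogHolderCocycle

/-! ### Assembly of the theorem. -/

theorem theorem1 (ρ δ p σ : ℝ) (hρ0 : 0 < ρ) (hρ1 : ρ < 1) (hδ0 : 0 < δ) (hδ1 : δ < 1)
    (hp0 : 0 < p) (hp1 : p < 1) (hσ : 1 < σ) :
    -- the exponents of the cocycle are `± p log σ ≠ 0`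
    (LogHolderCocycle.IsUpperExponent p (LogHolderCocycle.cocA σ hσ) (p * Real.log σ) ∧
      LogHolderCocycle.IsLowerExponent p (LogHolderCocycle.cocA σ hσ) (-(p * Real.log σ)) ∧
      p * Real.log σ ≠ 0) ∧
    -- it lies on the boundary of the uniformly hyperbolic set
    LogHolderCocycle.cocA σ hσ ∈ frontier LogHolderCocycle.UH ∧
    -- it is a limit, in the `δ`-log norm, of cocycles with vanishing exponents
    (LogHolderCocycle.cocA σ hσ ∈ LogHolderCocycle.CLog ρ δ ∧
      ∀ ε : ENNReal, 0 < ε → ∃ B ∈ LogHolderCocycle.CLog ρ δ,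
        LogHolderCocycle.logDist ρ δ B (LogHolderCocycle.cocA σ hσ) < ε ∧
        LogHolderCocycle.ZeroExponents p B) ∧
    -- it is a discontinuity point of the exponents in the `δ`-log topology
    (¬ LogHolderCocycle.LogContinuousAt ρ δ (LogHolderCocycle.upperExponent p)
        (LogHolderCocycle.cocA σ hσ) ∧
      ¬ LogHolderCocycle.LogContinuousAt ρ δ (LogHolderCocycle.lowerExponent p)
        (LogHolderCocycle.cocA σ hσ)) ∧
    -- the coordinate lines are invariant under the cocycle
    (∀ (x : LogHolderCocycle.Shift2) (i : Fin 2),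
      (LogHolderCocycle.axis i).map
        (LogHolderCocycle.act (LogHolderCocycle.cocA σ hσ x)).toLinearMap =
        LogHolderCocycle.axis i) ∧
    -- first explicit family of approximants
    ((∀ k : ℕ, 1 ≤ k →
        LogHolderCocycle.cocB σ hσ k ∈ LogHolderCocycle.CLog ρ δ ∧
        LogHolderCocycle.ZeroExponents p (LogHolderCocycle.cocB σ hσ k) ∧
        ∀ x ∈ LogHolderCocycle.cylZ k,
          LogHolderCocycle.SwapsAxes
            (LogHolderCocycle.iter (LogHolderCocycle.cocB σ hσ k) (k : ℤ) x)) ∧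
      Filter.Tendsto (fun k : ℕ => LogHolderCocycle.logDist ρ δ
        (LogHolderCocycle.cocB σ hσ k) (LogHolderCocycle.cocA σ hσ)) Filter.atTop (nhds 0)) ∧
    -- second explicit family of approximants
    (∀ β : ℝ, δ < β → β < 1 →
      (∀ k : ℕ, 2 ≤ k →
        LogHolderCocycle.cocL σ hσ β k ∈ LogHolderCocycle.CLog ρ δ ∧
        LogHolderCocycle.ZeroExponents p (LogHolderCocycle.cocL σ hσ β k) ∧
        ∀ x ∈ LogHolderCocycle.cylW k,
          LogHolderCocycle.SwapsAxes
            (LogHolderCocycle.iter (LogHolderCocycle.cocL σ hσ β k) (2 * (k : ℤ) + 1) x)) ∧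
      Filter.Tendsto (fun k : ℕ => LogHolderCocycle.logDist ρ δ
        (LogHolderCocycle.cocL σ hσ β k) (LogHolderCocycle.cocA σ hσ)) Filter.atTop (nhds 0)) := by
  have hA := LogHolderCocycle.isUpperExponent_cocA hp0.le hp1.le hσ
  have hne : p * Real.log σ ≠ 0 := (mul_pos hp0 (Real.log_pos hσ)).ne'
  have hCB : ∀ k, LogHolderCocycle.cocB σ hσ k ∈ LogHolderCocycle.CLog ρ δ := fun k =>
    LogHolderCocycle.mem_CLog_of_dependsOn hρ0 hρ1 hδ0 (LogHolderCocycle.dependsOn_cocB σ hσ k)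
  have hlim := LogHolderCocycle.tendsto_logDist_cocB hρ0 hρ1 hδ0 hδ1 hσ
  have happrox : ∀ ε : ENNReal, 0 < ε → ∃ B ∈ LogHolderCocycle.CLog ρ δ,
      LogHolderCocycle.logDist ρ δ B (LogHolderCocycle.cocA σ hσ) < ε ∧
      LogHolderCocycle.ZeroExponents p B := by
    intro ε hε
    obtain ⟨k, hk, hk1⟩ := ((hlim.eventually_lt_const hε).and
      (Filter.eventually_ge_atTop 1)).exists
    exact ⟨_, hCB k, hk, LogHolderCocycle.zeroExponents_cocB hp0 hp1 hσ hk1⟩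
  refine ⟨⟨hA, LogHolderCocycle.isLowerExponent_of_isUpperExponent hA, hne⟩,
    LogHolderCocycle.cocA_mem_frontier_UH σ hσ,
    ⟨LogHolderCocycle.mem_CLog_of_dependsOn hρ0 hρ1 hδ0 (LogHolderCocycle.dependsOn_cocA σ hσ),
      happrox⟩,
    ⟨LogHolderCocycle.not_logContinuousAt (hA.upperExponent_eq hp0.le hp1.le) hne fun ε hε => ?_,
      LogHolderCocycle.not_logContinuousAt
        ((LogHolderCocycle.isLowerExponent_of_isUpperExponent hA).lowerExponent_eq hp0.le hp1.le)
        (neg_ne_zero.mpr hne) fun ε hε => ?_⟩,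
    LogHolderCocycle.map_axis_cocA σ hσ,
    ⟨fun k hk => ⟨hCB k, LogHolderCocycle.zeroExponents_cocB hp0 hp1 hσ hk,
      fun x hx => LogHolderCocycle.swapsAxes_cocB hσ hk hx⟩, hlim⟩,
    fun β hδβ hβ1 => ⟨fun k hk => ⟨?_, LogHolderCocycle.zeroExponents_cocL hp0 hp1 hσ β hk,
      fun x hx => LogHolderCocycle.swapsAxes_cocL hσ β hk hx⟩,
      LogHolderCocycle.tendsto_logDist_cocL hρ0 hρ1 hδ0 hσ hδβ hβ1⟩⟩
  · obtain ⟨B, hB, hd, hz⟩ := happrox ε hε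
    exact ⟨B, hB, hd, hz.1.upperExponent_eq hp0.le hp1.le⟩
  · obtain ⟨B, hB, hd, hz⟩ := happrox ε hε
    exact ⟨B, hB, hd, hz.2.lowerExponent_eq hp0.le hp1.le⟩
  · exact LogHolderCocycle.mem_CLog_of_dependsOn hρ0 hρ1 hδ0
      (LogHolderCocycle.dependsOn_cocL σ hσ β (by omega))
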